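/- **Setting.** An age-of-information stochastic hybrid system (AoI SHS) consists of a finite set $\mathcal Q$ of discrete states, a finite set $\mathcal L$ of transitions, an integer $n\ge 0$, for each $q\in\mathcal Q$ a row vector $b_q\in\{0,1\}^{n+1}$, and for each $l\in\mathcal L$ a source state $q_l\in\mathcal Q$, a target state $q_l'\in\mathcal Q$, a rate $\lambda^{(l)}\ge 0$ and a matrix $A_l\in\{0,1\}^{(n+1)\times(n+1)}$; self-transitions and parallel transitions are allowed. Component $j$ is called irrelevant in state $q$ if $[b_q]_j=0$, and then column $j$ of $A_l$ is zero for every transition $l$ into $q$. At least one rate is positive. A realization of the AoI SHS is a process $(q(t),x(t))_{t\ge0}$ with values in $\mathcal Q\times\mathbb R^{n+1}$, $x(t)=(x_0(t),\dots,x_n(t))$, adapted to a filtration on a probability space, together with adapted counting processes $N_l(t)$ of the transitions, no two transitions occurring at the same time, such that almost surely: between transitions $q(t)$ is constant and $\dot x(t)=b_{q(t)}$; when transition $l$ occurs, the discrete state jumps from $q_l$ to $q_l'$ and $x$ is reset to $xA_l$; and such that $N_l$ has stochastic intensity $\lambda^{(l)}\mathbf 1\{q(t)=q_l\}$, i.e.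 $N_l(t)-\int_0^t\lambda^{(l)}\mathbf 1\{q(u)=q_l\}\,du$ is a martingale. In particular $q(t)$ is a continuous-time Markov chain. **Theorem.** Suppose that the chain $q(t)$ is ergodic (irreducible: any state can be reached from any other through transitions of positive rate), with stationary distribution $\bar\pi$, i.e. $\bar\pi_q\ge0$, $\sum_q\bar\pi_q=1$ and $\bar\pi_q\sum_{l:\,q_l=q}\lambda^{(l)}=\sum_{l:\,q_l'=q}\lambda^{(l)}\bar\pi_{q_l}$ for all $q\in\mathcal Q$. Suppose that the row vectors $\bar v_q=(\bar v_{q0},\dots,\bar v_{qn})$, $q\in\mathcal Q$, have non-negative entries and satisfy $$\bar v_q\sum_{l:\,q_l=q}\lambda^{(l)}=b_q\bar\pi_q+\sum_{l:\,q_l'=q}\lambda^{(l)}\,\bar v_{q_l}A_l,\qquad q\in\mathcal Q.$$ Then: 1. The linear differential equation $$\dot v_q(t)=b_q\bar\pi_q+\sum_{l:\,q_l'=q}\lambda^{(l)}\,v_{q_l}(t)A_l-v_q(t)\sum_{l:\,q_l=q}\lambda^{(l)},\qquad q\in\mathcal Q,$$ is stable with equilibrium $\bar v$: there are constants $C$ and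 $c>0$ such that every solution on $[0,\infty)$ satisfies $\|v(t)-\bar v\|\le Ce^{-ct}\|v(0)-\bar v\|$ for all $t\ge0$. 2. For every realization of the AoI SHS whose initial value $x(0)$ is integrable, and whatever the distribution of $(q(0),x(0))$, the age $x_0(t)$ is integrable for every $t\ge0$, and the average age is $$\Delta=\lim_{t\to\infty}\mathbb E[x_0(t)]=\sum_{q\in\mathcal Q}\bar v_{q0}.$$ -/

import Mathlib

open MeasureTheory Filter Topology
open scoped NNReal Matrix

/-- An age-of-information stochastic hybrid system with discrete states `Q`, transitions `L` and
continuous state in `ℝ^(n+1)` (row vectors `x = (x_0, …, x_n)`; `x_0` is the age at the monitor).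
Transition `l` goes from `src l` to `dst l` at rate `rate l` and resets `x` to `x A_l`; in state `q`
the continuous state has the constant slope `b q`. Self-transitions and parallel transitions are
allowed. -/
structure AoISHS (Q L : Type*) (n : ℕ) where
  src : L → Q
  dst : L → Q
  rate : L → ℝ
  rate_nonneg : ∀ l, 0 ≤ rate l
  b : Q → Fin (n + 1) → ℝ
  b_binary : ∀ q j, b q j = 0 ∨ b q j = 1
  A : L → Matrix (Fin (n + 1)) (Fin (n + 1)) ℝ
  A_binary : ∀ l i j, A l i j = 0 ∨ A l i j = 1
  /-- A component `j` with `b q j = 0` is irrelevant in state `q` (the relevant ones are those with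
  `b q j = 1`), and every transition into `q` resets it to zero. -/
  irrelevant_reset : ∀ l j, b (dst l) j = 0 → ∀ i, A l i j = 0

namespace AoISHS

variable {Q L : Type*} {n : ℕ}

/-- `q'` can be reached from `q` by one transition that has positive rate. -/
def Step (S : AoISHS Q L n) (q q' : Q) : Prop :=
  ∃ l, S.src l = q ∧ S.dst l = q' ∧ 0 < S.rate l

/-- Ergodicity of the finite-state continuous-time Markov chain `q(t)`: the chain is irreducible,
that is, every state can be reached from every state. (In continuous time there is no periodicity,
and on a finite state space irreducibility gives positive recurrence.) -/
def Ergodic (S : AoISHS Q L n) : Prop :=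
  ∀ q q' : Q, Relation.ReflTransGen S.Step q q'

/-- The total rate of the transitions out of `q` (self-transitions included). -/
noncomputable def outRate [Fintype L] [DecidableEq Q] (S : AoISHS Q L n) (q : Q) : ℝ :=
  ∑ l with S.src l = q, S.rate l

/-- `p` is a stationary distribution of the discrete-state Markov chain. -/
def IsStationary [Fintype Q] [Fintype L] [DecidableEq Q] (S : AoISHS Q L n) (p : Q → ℝ) : Prop :=
  (∀ q, 0 ≤ p q) ∧ ∑ q, p q = 1 ∧
    ∀ q, p q * S.outRate q = ∑ l with S.dst l = q, S.rate l * p (S.src l)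

/-- `w` solves the linear equations
`w_q ∑_{l out of q} λ_l = b_q p_q + ∑_{l into q} λ_l w_{q_l} A_l`. -/
def IsBalanced [Fintype L] [DecidableEq Q] (S : AoISHS Q L n) (p : Q → ℝ)
    (w : Q → Fin (n + 1) → ℝ) : Prop :=
  ∀ q, S.outRate q • w q =
    p q • S.b q + ∑ l with S.dst l = q, S.rate l • (w (S.src l) ᵥ* S.A l)

/-- The right-hand side of the moment differential equation with stationary probabilities `p`,
`v̇_q = b_q p_q + ∑_{l into q} λ_l v_{q_l} A_l - v_q ∑_{l out of q} λ_l`. -/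
noncomputable def momentField [Fintype L] [DecidableEq Q] (S : AoISHS Q L n) (p : Q → ℝ)
    (v : Q → Fin (n + 1) → ℝ) : Q → Fin (n + 1) → ℝ :=
  fun q => p q • S.b q + (∑ l with S.dst l = q, S.rate l • (v (S.src l) ᵥ* S.A l))
    - S.outRate q • v q

/-- `v` solves the moment differential equation on `[0, ∞)`. -/
def IsMomentSolution [Fintype Q] [Fintype L] [DecidableEq Q] (S : AoISHS Q L n) (p : Q → ℝ)
    (v : ℝ → Q → Fin (n + 1) → ℝ) : Prop :=
  ∀ t, 0 ≤ t → HasDerivWithinAt v (S.momentField p (v t)) (Set.Ici 0) t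

/-- The moment differential equation is stable, with equilibrium `w`: all its solutions converge
to `w`, uniformly exponentially fast. (For a linear equation with constant coefficients this is
the same as asymptotic stability, and as all eigenvalues having negative real part.) -/
def MomentStable [Fintype Q] [Fintype L] [DecidableEq Q] (S : AoISHS Q L n) (p : Q → ℝ)
    (w : Q → Fin (n + 1) → ℝ) : Prop :=
  S.momentField p w = 0 ∧
    ∃ C c : ℝ, 0 < c ∧ ∀ v : ℝ → Q → Fin (n + 1) → ℝ, S.IsMomentSolution p v →
      ∀ t, 0 ≤ t → ‖v t - w‖ ≤ C * Real.exp (-c * t) * ‖v 0 - w‖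

/-- Sample paths of the system: `N l t` is the number of occurrences of transition `l` in
`[0, t]`, `q t` the discrete and `x t` the continuous state at time `t`. -/
structure IsPath [Fintype L] (S : AoISHS Q L n) (N : L → ℝ≥0 → ℕ) (q : ℝ≥0 → Q)
    (x : ℝ≥0 → Fin (n + 1) → ℝ) : Prop where
  count_zero : ∀ l, N l 0 = 0
  count_mono : ∀ l, Monotone (N l)
  /-- The (integer valued, non-decreasing) counts are right-continuous. -/
  count_right : ∀ l t, ∃ u, t < u ∧ N l u = N l t
  /-- At any time at most one transition occurs. -/
  count_simple : ∀ t, 0 < t → ∃ s, s < t ∧ ∑ l, N l t ≤ ∑ l, N l s + 1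
  /-- As long as no transition occurs, `q` is constant and `x` grows with slope `b q`. -/
  flow : ∀ s t, s ≤ t → (∀ k, N k t = N k s) →
    q t = q s ∧ x t = x s + ((t : ℝ) - s) • S.b (q s)
  /-- If transition `l` occurs at time `t` and no transition occurs in `(s, t)`, then the discrete
  state jumps from `src l` to `dst l`, and the continuous state is reset to its left limit
  `x s + (t - s) b` times `A l`. -/
  jump : ∀ s t l, s < t → (∀ r, s ≤ r → r < t → ∀ k, N k r = N k s) → N l t = N l s + 1 →
    q s = S.src l ∧ q t = S.dst l ∧
      x t = (x s + ((t : ℝ) - s) • S.b (S.src l)) ᵥ* S.A l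

open Classical in
/-- `(q, x)`, with the transition counts `N`, is a stochastic process on the filtered probability
space `(Ω, ℱ, μ)` that evolves as the stochastic hybrid system `S`: almost all sample paths follow
the dynamics, and the counting process `N l` has the stochastic intensity `rate l` while
`q = src l` and `0` otherwise. The initial state is arbitrary. -/
structure IsRealization [Fintype L] (S : AoISHS Q L n) {Ω : Type*} [mΩ : MeasurableSpace Ω]
    (μ : Measure Ω) (ℱ : Filtration ℝ≥0 mΩ) (N : L → ℝ≥0 → Ω → ℕ) (q : ℝ≥0 → Ω → Q)
    (x : ℝ≥0 → Ω → Fin (n + 1) → ℝ) : Prop where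
  count_adapted : ∀ l t, Measurable[ℱ t] (N l t)
  discrete_adapted : ∀ t i, MeasurableSet[ℱ t] {ω | q t ω = i}
  continuous_adapted : ∀ t, Measurable[ℱ t] (x t)
  path : ∀ᵐ ω ∂μ, S.IsPath (fun l t => N l t ω) (fun t => q t ω) (fun t => x t ω)
  /-- The compensated counting processes are martingales. -/
  intensity : ∀ l, Martingale
    (fun (t : ℝ≥0) (ω : Ω) => (N l t ω : ℝ) -
      ∫ u in (0 : ℝ)..t, S.rate l * (if q u.toNNReal ω = S.src l then 1 else 0)) ℱ μ

end AoISHS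

/-! The balanced vector is itself almost a Lyapunov weight. The linear part of the moment equation
sends `w` to `-p b`, which is strictly negative on relevant components because ergodicity makes `p`
positive. Irrelevant components receive no inflow and only decay, so adding a small positive
constant there gives a strictly positive `u` whose image is at most `-c u`
(`exists_contracting_weight`). The linear part has non-negative off-diagonal coefficients, so
comparison with `u` gives exponential decay in the supremum norm weighted by `u`, even under an
exponentially small forcing (`abs_le_of_hasDerivWithinAt_linField`). Without forcing this is the
stability claim.

For the probabilistic claim, the expectations of `x` on the events `{q = a}` solve the same equation
with the current law of `q(t)` in place of `p`. This follows from Dynkin's formula for observables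
`α_q + β_q · x`, proved by a short-time expansion. On an interval of length `d`, no jump gives the
exact drift. One jump gives the reset up to an error proportional to `d`, on an event whose
probability is also of order `d`. Several jumps are controlled by exponential moments of the jump
count, obtained from the martingale property alone (`lintegral_mul_pow_jumps_le`). The total error
is of order `d ^ 2` (`abs_integral_obs_sub_le`), which yields right derivatives and continuity.

The law of `q(t)` converges exponentially to `p` by a Poincaré inequality (`exists_poincare`,
`exists_abs_le_exp_of_forward`). Hence the deviation of the moments from `w` solves the contracting
equation with an exponentially small forcing (`tendsto_moment`), and summing over states gives the
average age. -/

namespace AoISHS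

/-! ### The linear moment equation and its contraction. -/

variable {Q L : Type*} {n : ℕ}

/-- The linear part of the moment differential equation. -/
noncomputable def linField [Fintype L] [DecidableEq Q] (S : AoISHS Q L n)
    (v : Q → Fin (n + 1) → ℝ) : Q → Fin (n + 1) → ℝ :=
  fun q => (∑ l with S.dst l = q, S.rate l • (v (S.src l) ᵥ* S.A l)) - S.outRate q • v q

theorem momentField_eq_add_linField [Fintype L] [DecidableEq Q] (S : AoISHS Q L n) (p : Q → ℝ)
    (v : Q → Fin (n + 1) → ℝ) :
    S.momentField p v = fun q => p q • S.b q + S.linField v q := by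
  funext q
  simp only [momentField, linField, add_sub_assoc]

theorem linField_apply [Fintype L] [DecidableEq Q] (S : AoISHS Q L n)
    (v : Q → Fin (n + 1) → ℝ) (q : Q) (j : Fin (n + 1)) :
    S.linField v q j = (∑ l with S.dst l = q, S.rate l * (v (S.src l) ᵥ* S.A l) j)
      - S.outRate q * v q j := by
  simp [linField, Finset.sum_apply]

theorem linField_sub [Fintype L] [DecidableEq Q] (S : AoISHS Q L n)
    (v w : Q → Fin (n + 1) → ℝ) : S.linField (v - w) = S.linField v - S.linField w := by
  funext q j
  simp only [linField_apply, Pi.sub_apply, Matrix.sub_vecMul, mul_sub, Finset.sum_sub_distrib]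
  ring

theorem linField_add_smul [Fintype L] [DecidableEq Q] (S : AoISHS Q L n)
    (v w : Q → Fin (n + 1) → ℝ) (a : ℝ) :
    S.linField (v + a • w) = S.linField v + a • S.linField w := by
  funext q j
  simp only [linField_apply, Pi.add_apply, Pi.smul_apply, Matrix.add_vecMul, Matrix.smul_vecMul,
    mul_add, Finset.sum_add_distrib, smul_eq_mul, mul_sub, Finset.mul_sum, mul_left_comm _ a]
  ring

theorem momentField_eq_zero [Fintype L] [DecidableEq Q] {S : AoISHS Q L n} {p : Q → ℝ}
    {w : Q → Fin (n + 1) → ℝ} (hw : S.IsBalanced p w) : S.momentField p w = 0 := by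
  funext q
  simp only [momentField, Pi.zero_apply]
  rw [← hw q, sub_self]

theorem linField_of_isBalanced [Fintype L] [DecidableEq Q] {S : AoISHS Q L n} {p : Q → ℝ}
    {w : Q → Fin (n + 1) → ℝ} (hw : S.IsBalanced p w) (q : Q) :
    S.linField w q = -(p q • S.b q) := by
  have h := congrFun (momentField_eq_zero hw) q
  rw [momentField_eq_add_linField] at h
  exact eq_neg_of_add_eq_zero_right h

theorem A_nonneg (S : AoISHS Q L n) (l : L) (i j : Fin (n + 1)) : 0 ≤ S.A l i j := by
  rcases S.A_binary l i j with h | h <;> simp [h]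

theorem vecMul_A_le (S : AoISHS Q L n) (l : L) {v u : Fin (n + 1) → ℝ} (h : ∀ i, v i ≤ u i)
    (j : Fin (n + 1)) : (v ᵥ* S.A l) j ≤ (u ᵥ* S.A l) j := by
  simp only [Matrix.vecMul, dotProduct]
  exact Finset.sum_le_sum fun i _ => mul_le_mul_of_nonneg_right (h i) (S.A_nonneg l i j)

theorem abs_vecMul_A_le (S : AoISHS Q L n) (l : L) {v u : Fin (n + 1) → ℝ}
    (h : ∀ i, |v i| ≤ u i) (j : Fin (n + 1)) : |(v ᵥ* S.A l) j| ≤ (u ᵥ* S.A l) j := by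
  refine abs_le.2 ⟨?_, S.vecMul_A_le l (fun i => (le_abs_self _).trans (h i)) j⟩
  have := S.vecMul_A_le l (v := -u) (u := v) (fun i => (abs_le.1 (h i)).1) j
  simpa [Matrix.neg_vecMul] using this

theorem outRate_nonneg [Fintype L] [DecidableEq Q] (S : AoISHS Q L n) (q : Q) :
    0 ≤ S.outRate q :=
  Finset.sum_nonneg fun l _ => S.rate_nonneg l

/-- A path from `q` to the source of some positive-rate transition is either empty, and then that
transition leaves `q`, or starts with a positive-rate transition out of `q`. Irreducibility alone
would not suffice: a single state without transitions is irreducible. -/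
theorem outRate_pos [Fintype L] [DecidableEq Q] {S : AoISHS Q L n}
    (hrate : ∃ l, 0 < S.rate l) (herg : S.Ergodic) (q : Q) : 0 < S.outRate q := by
  obtain ⟨l₀, hl₀⟩ := hrate
  have key : ∃ l, S.src l = q ∧ 0 < S.rate l := by
    rcases Relation.ReflTransGen.cases_head (herg q (S.src l₀)) with h | ⟨r, ⟨l, h1, _, h3⟩, _⟩
    · exact ⟨l₀, h.symm, hl₀⟩
    · exact ⟨l, h1, h3⟩
  obtain ⟨l, hl, hl'⟩ := key
  exact Finset.sum_pos' (fun l _ => S.rate_nonneg l) ⟨l, by simp [hl], hl'⟩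

/-- By stationarity, a state of mass zero has no inflow, so zeros propagate backwards along
positive-rate transitions. By irreducibility one zero would annihilate the total mass. -/
theorem IsStationary.pos [Fintype Q] [Fintype L] [DecidableEq Q] {S : AoISHS Q L n}
    (herg : S.Ergodic) {p : Q → ℝ} (hp : S.IsStationary p) (q : Q) : 0 < p q := by
  obtain ⟨h0, h1, h2⟩ := hp
  refine (h0 q).lt_of_ne' fun hq => ?_
  have back : ∀ a b, S.Step a b → p b = 0 → p a = 0 := by
    rintro a b ⟨l, rfl, rfl, hl⟩ hb
    have h := h2 (S.dst l)
    rw [hb, zero_mul, eq_comm, Finset.sum_eq_zero_iff_of_nonneg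
      fun l _ => mul_nonneg (S.rate_nonneg l) (h0 _)] at h
    have := h l (by simp)
    exact (mul_eq_zero.1 this).resolve_left hl.ne'
  have all : ∀ a, p a = 0 := fun a =>
    Relation.ReflTransGen.head_induction_on (motive := fun a _ => p a = 0) (herg a q) hq
      fun h _ ih => back _ _ h ih
  simp [all] at h1

theorem exists_pos_forall_lt_of_finite {ι : Type*} [Finite ι] {f : ι → ℝ} (hf : ∀ i, 0 < f i) :
    ∃ c > 0, ∀ i, c < f i := by
  have h : ∀ᶠ c in 𝓝[>] (0 : ℝ), ∀ i, c < f i :=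
    eventually_all.2 fun i => nhdsWithin_le_nhds (Iio_mem_nhds (hf i))
  obtain ⟨c, hc, hc'⟩ := (h.and self_mem_nhdsWithin).exists
  exact ⟨c, hc', hc⟩

/-- A positive vector that the linear part of the moment equation contracts. -/
theorem exists_contracting_weight [Fintype Q] [Fintype L] [DecidableEq Q] {S : AoISHS Q L n}
    (hrate : ∃ l, 0 < S.rate l) (herg : S.Ergodic)
    {p : Q → ℝ} (hp : S.IsStationary p) {w : Q → Fin (n + 1) → ℝ} (hw0 : ∀ q j, 0 ≤ w q j)
    (hw : S.IsBalanced p w) :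
    ∃ u : Q → Fin (n + 1) → ℝ, ∃ c > 0, (∀ q j, 0 < u q j) ∧
      ∀ q j, S.linField u q j ≤ -(c * u q j) := by
  -- The balanced vector may vanish on irrelevant components and has image `0` there. The correction
  -- `ε • e` makes them positive, and `ε` is small enough not to spoil the strict sign `-p q` on the
  -- relevant ones.
  set e : Q → Fin (n + 1) → ℝ := fun q j => if S.b q j = 0 then 1 else 0 with he
  have hev : ∀ᶠ ε in 𝓝[>] (0 : ℝ), ∀ q j, ε * S.linField e q j < p q := by
    refine eventually_all.2 fun q => eventually_all.2 fun j => nhdsWithin_le_nhds ?_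
    have hc : Continuous fun ε : ℝ => ε * S.linField e q j := by fun_prop
    refine hc.continuousAt.eventually_lt continuousAt_const ?_
    simpa using hp.pos herg q
  obtain ⟨ε, hε, hε0 : 0 < ε⟩ := (hev.and self_mem_nhdsWithin).exists
  set u := w + ε • e with hu
  have hu0 : ∀ q j, 0 < u q j := by
    intro q j
    rcases S.b_binary q j with hb | hb
    · have := hw0 q j
      simp only [hu, he, Pi.add_apply, Pi.smul_apply, hb, smul_eq_mul]
      simp only [if_true]
      linarith
    · have hq := congrFun (hw q) j
      simp only [Pi.add_apply, Pi.smul_apply, Finset.sum_apply, smul_eq_mul, hb, mul_one] at hq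
      have hs : 0 ≤ ∑ l with S.dst l = q, S.rate l * (w (S.src l) ᵥ* S.A l) j := by
        refine Finset.sum_nonneg fun l _ => mul_nonneg (S.rate_nonneg l) ?_
        simpa using S.vecMul_A_le l (v := 0) (u := w (S.src l)) (fun i => hw0 _ i) j
      have hwp : 0 < w q j := by
        refine pos_of_mul_pos_right ?_ (S.outRate_nonneg q)
        rw [hq]
        exact add_pos_of_pos_of_nonneg (hp.pos herg q) hs
      simp [hu, he, hb, hwp]
  have hneg : ∀ q j, S.linField u q j < 0 := by
    intro q j
    rcases S.b_binary q j with hb | hb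
    · have hz : ∑ l with S.dst l = q, S.rate l * (u (S.src l) ᵥ* S.A l) j = 0 := by
        refine Finset.sum_eq_zero fun l hl => ?_
        have hl' : S.dst l = q := by simpa using hl
        simp [Matrix.vecMul, dotProduct, S.irrelevant_reset l j (by rw [hl', hb])]
      rw [linField_apply, hz, zero_sub, neg_lt_zero]
      exact mul_pos (outRate_pos hrate herg q) (hu0 q j)
    · have h := hε q j
      rw [hu, linField_add_smul]
      simp only [Pi.add_apply, Pi.smul_apply, smul_eq_mul, linField_of_isBalanced hw, Pi.neg_apply,
        hb, mul_one]
      linarith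
  obtain ⟨c, hc0, hc⟩ := exists_pos_forall_lt_of_finite
    (f := fun i : Q × Fin (n + 1) => -S.linField u i.1 i.2 / u i.1 i.2)
    fun i => div_pos (neg_pos.2 (hneg _ _)) (hu0 _ _)
  refine ⟨u, c, hc0, hu0, fun q j => ?_⟩
  have := (lt_div_iff₀ (hu0 q j)).1 (hc (q, j))
  linarith

/-- Exponential decay, in the weighted supremum norm, of the solutions of the linear equation with
an exponentially small perturbation. -/
theorem abs_le_of_hasDerivWithinAt_linField [Fintype Q] [Fintype L] [DecidableEq Q]
    {S : AoISHS Q L n} {u : Q → Fin (n + 1) → ℝ} {c η D K : ℝ} (hu : ∀ q j, 0 < u q j)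
    (huc : ∀ q j, S.linField u q j ≤ -(c * u q j))
    {z r : ℝ → Q → Fin (n + 1) → ℝ} (hz : ContinuousOn z (Set.Ici 0))
    (hz' : ∀ t, 0 ≤ t → HasDerivWithinAt z (S.linField (z t) + r t) (Set.Ici t) t)
    (hr : ∀ t, 0 ≤ t → ∀ q j, |r t q j| ≤ D * Real.exp (-η * t)) (hK : 0 ≤ K)
    (hD : ∀ q j, D < K * (c - η) * u q j)
    (h0 : ∀ q j, |z 0 q j| ≤ K * u q j) {t : ℝ} (ht : 0 ≤ t) (q : Q) (j : Fin (n + 1)) :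
    |z t q j| ≤ K * u q j * Real.exp (-η * t) := by
  -- With `κ` above all exit rates, `κ + linField` has non-negative coefficients, so it preserves
  -- bounds by multiples of `u`. The factor `exp (κ t)` and the division by `u` turn the claim into
  -- a bound on the plain norm of `y`.
  obtain ⟨κ, hκ⟩ : ∃ κ, ∀ q, S.outRate q ≤ κ :=
    ⟨∑ q, S.outRate q, fun q =>
      Finset.single_le_sum (fun q _ => S.outRate_nonneg q) (Finset.mem_univ q)⟩
  set y : ℝ → Q → Fin (n + 1) → ℝ := fun t q j => Real.exp (κ * t) * z t q j / u q j with hy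
  set y' : ℝ → Q → Fin (n + 1) → ℝ := fun t q j =>
    (κ * Real.exp (κ * t) * z t q j + Real.exp (κ * t) * (S.linField (z t) + r t) q j) / u q j
    with hy'
  have hyc : ContinuousOn y (Set.Icc 0 t) := by
    refine continuousOn_pi.2 fun q => continuousOn_pi.2 fun j => ?_
    have h1 : ContinuousOn (fun t => z t q j) (Set.Icc 0 t) :=
      (continuousOn_pi.1 (continuousOn_pi.1 (hz.mono Set.Icc_subset_Ici_self) q) j)
    have h2 : Continuous fun t : ℝ => Real.exp (κ * t) := by fun_prop
    exact (h2.continuousOn.mul h1).div_const _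
  have hyd : ∀ s ∈ Set.Ico 0 t, HasDerivWithinAt y (y' s) (Set.Ici s) s := by
    intro s hs
    refine hasDerivWithinAt_pi.2 fun q => hasDerivWithinAt_pi.2 fun j => ?_
    have h1 := hasDerivWithinAt_pi.1 (hasDerivWithinAt_pi.1 (hz' s hs.1) q) j
    have h2 : HasDerivAt (fun t : ℝ => Real.exp (κ * t)) (κ * Real.exp (κ * s)) s := by
      have := (((hasDerivAt_id s).const_mul κ).exp)
      simpa [mul_comm] using this
    exact (h2.hasDerivWithinAt.mul h1).div_const _
  have hB : ∀ s, HasDerivAt (fun s => K * Real.exp ((κ - η) * s))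
      (K * ((κ - η) * Real.exp ((κ - η) * s))) s := by
    intro s
    have := (((hasDerivAt_id s).const_mul (κ - η)).exp).const_mul K
    simpa [mul_comm] using this
  have hy0 : ‖y 0‖ ≤ K * Real.exp ((κ - η) * 0) := by
    rw [mul_zero, Real.exp_zero, mul_one]
    refine (pi_norm_le_iff_of_nonneg hK).2 fun q => (pi_norm_le_iff_of_nonneg hK).2 fun j => ?_
    simp only [hy, mul_zero, Real.exp_zero, one_mul, Real.norm_eq_abs, abs_div,
      abs_of_pos (hu q j)]
    exact (div_le_iff₀ (hu q j)).2 (h0 q j)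
  -- The barrier argument needs a strict inequality of slopes only at times when the norm touches
  -- the barrier; `hD` supplies the strictness.
  have bound : ∀ s ∈ Set.Ico 0 t, ‖y s‖ = K * Real.exp ((κ - η) * s) →
      ‖y' s‖ < K * ((κ - η) * Real.exp ((κ - η) * s)) := by
    intro s hs hys
    set m := K * Real.exp (-η * s) with hm
    have hexp : Real.exp ((κ - η) * s) = Real.exp (κ * s) * Real.exp (-η * s) := by
      rw [← Real.exp_add]; ring_nf
    have hm0 : 0 ≤ m := mul_nonneg hK (Real.exp_pos _).le
    have hzm : ∀ q j, |z s q j| ≤ m * u q j := by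
      intro q j
      have h1 : |y s q j| ≤ K * Real.exp ((κ - η) * s) :=
        hys ▸ (norm_le_pi_norm (y s q) j).trans (norm_le_pi_norm (y s) q)
      simp only [hy, abs_div, abs_of_pos (hu q j), abs_mul, Real.abs_exp] at h1
      rw [div_le_iff₀ (hu q j), hexp] at h1
      refine le_of_mul_le_mul_left (h1.trans_eq ?_) (Real.exp_pos (κ * s))
      rw [hm]; ring
    have hlin : ∀ q j, |κ * z s q j + S.linField (z s) q j| ≤ m * (κ - c) * u q j := by
      intro q j
      have e1 : κ * z s q j + S.linField (z s) q j = (κ - S.outRate q) * z s q j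
          + ∑ l with S.dst l = q, S.rate l * (z s (S.src l) ᵥ* S.A l) j := by
        rw [linField_apply]; ring
      have e2 : m * (κ * u q j + S.linField u q j) = (κ - S.outRate q) * (m * u q j)
          + ∑ l with S.dst l = q, S.rate l * ((m • u (S.src l)) ᵥ* S.A l) j := by
        rw [linField_apply]
        simp only [Matrix.smul_vecMul, Pi.smul_apply, smul_eq_mul, mul_left_comm _ m,
          ← Finset.mul_sum]
        ring
      have e3 : |κ * z s q j + S.linField (z s) q j| ≤ m * (κ * u q j + S.linField u q j) := by
        rw [e1, e2]
        refine (abs_add_le _ _).trans (add_le_add ?_ ?_)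
        · rw [abs_mul, abs_of_nonneg (sub_nonneg.2 (hκ q))]
          exact mul_le_mul_of_nonneg_left (hzm q j) (sub_nonneg.2 (hκ q))
        · refine (Finset.abs_sum_le_sum_abs _ _).trans (Finset.sum_le_sum fun l _ => ?_)
          rw [abs_mul, abs_of_nonneg (S.rate_nonneg l)]
          exact mul_le_mul_of_nonneg_left
            (S.abs_vecMul_A_le l (fun i => by simpa using hzm (S.src l) i) j) (S.rate_nonneg l)
      refine e3.trans ?_
      rw [mul_assoc m]
      exact mul_le_mul_of_nonneg_left (by linarith [huc q j]) hm0
    have hcoord : ∀ q j, |y' s q j| < K * ((κ - η) * Real.exp ((κ - η) * s)) := by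
      intro q j
      have e1 : y' s q j = Real.exp (κ * s) *
          ((κ * z s q j + S.linField (z s) q j) + r s q j) / u q j := by
        simp only [hy', Pi.add_apply]; ring
      rw [e1, abs_div, abs_of_pos (hu q j), abs_mul, Real.abs_exp, div_lt_iff₀ (hu q j), hexp]
      have e2 : |κ * z s q j + S.linField (z s) q j + r s q j| < m * (κ - η) * u q j := by
        have h1 := (abs_add_le (κ * z s q j + S.linField (z s) q j) (r s q j)).trans
          (add_le_add (hlin q j) (hr s hs.1 q j))
        have h2 := mul_lt_mul_of_pos_right (hD q j) (Real.exp_pos (-η * s))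
        have h3 : K * (c - η) * u q j * Real.exp (-η * s) = m * (c - η) * u q j := by
          rw [hm]; ring
        rw [h3] at h2
        linarith
      calc Real.exp (κ * s) * |κ * z s q j + S.linField (z s) q j + r s q j|
          < Real.exp (κ * s) * (m * (κ - η) * u q j) :=
            mul_lt_mul_of_pos_left e2 (Real.exp_pos _)
        _ = _ := by rw [hm]; ring
    have hpos : 0 < K * ((κ - η) * Real.exp ((κ - η) * s)) :=
      (abs_nonneg _).trans_lt (hcoord q j)
    refine (pi_norm_lt_iff hpos).2 fun q => (pi_norm_lt_iff hpos).2 fun j => hcoord q j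
  have main := image_norm_le_of_norm_deriv_right_lt_deriv_boundary hyc hyd hy0 hB bound
    (Set.right_mem_Icc.2 ht)
  have h1 : |y t q j| ≤ K * Real.exp ((κ - η) * t) :=
    ((norm_le_pi_norm (y t q) j).trans (norm_le_pi_norm (y t) q)).trans main
  have hexp : Real.exp ((κ - η) * t) = Real.exp (κ * t) * Real.exp (-η * t) := by
    rw [← Real.exp_add]; ring_nf
  simp only [hy, abs_div, abs_of_pos (hu q j), abs_mul, Real.abs_exp] at h1
  rw [div_le_iff₀ (hu q j), hexp] at h1
  refine le_of_mul_le_mul_left (h1.trans_eq ?_) (Real.exp_pos (κ * t))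
  ring

theorem momentStable_of_isBalanced [Fintype Q] [Fintype L] [DecidableEq Q] {S : AoISHS Q L n}
    (hrate : ∃ l, 0 < S.rate l) (herg : S.Ergodic) {p : Q → ℝ} (hp : S.IsStationary p)
    {w : Q → Fin (n + 1) → ℝ} (hw0 : ∀ q j, 0 ≤ w q j) (hw : S.IsBalanced p w) :
    S.MomentStable p w := by
  obtain ⟨u, c, hc, hu, huc⟩ := exists_contracting_weight hrate herg hp hw0 hw
  obtain ⟨a, ha, hau⟩ := exists_pos_forall_lt_of_finite
    (f := fun i : Q × Fin (n + 1) => u i.1 i.2) fun i => hu _ _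
  refine ⟨momentField_eq_zero hw, ‖u‖ / a, c / 2, half_pos hc, fun v hv t ht => ?_⟩
  have hbal : ∀ q, p q • S.b q + S.linField w q = 0 := fun q => by
    rw [linField_of_isBalanced hw]; simp
  have hz' : ∀ t, 0 ≤ t → HasDerivWithinAt (fun t => v t - w)
      (S.linField (v t - w) + 0) (Set.Ici t) t := by
    intro t ht
    have h := ((hv t ht).mono (Set.Ici_subset_Ici.2 ht)).sub_const w
    convert! h using 1
    rw [add_zero, linField_sub, momentField_eq_add_linField]
    funext q
    have := hbal q
    simp only [Pi.sub_apply]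
    rw [← sub_eq_zero, ← neg_eq_zero, ← this]
    abel
  have hzc : ContinuousOn (fun t => v t - w) (Set.Ici 0) := fun t ht =>
    (hv t ht).continuousWithinAt.sub continuousWithinAt_const
  set K := ‖v 0 - w‖ / a with hK
  -- The comparison requires a strictly positive constant, and `K` is zero when the solution starts
  -- at equilibrium; hence `K' > K`, followed by a limit.
  have key : ∀ K', K < K' → ∀ q j, |(v t - w) q j| ≤ K' * u q j * Real.exp (-(c / 2) * t) := by
    intro K' hK' q j
    have hKn : 0 ≤ K := by positivity
    have hK0 : 0 < K' := hKn.trans_lt hK'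
    refine abs_le_of_hasDerivWithinAt_linField (D := 0) (r := fun _ => 0) hu huc hzc hz' ?_
      hK0.le ?_ ?_ ht q j
    · intro t _ q j; simp
    · intro q j
      have := hu q j
      have : 0 < c - c / 2 := by linarith
      positivity
    · intro q j
      have h1 : |(v 0 - w) q j| ≤ ‖v 0 - w‖ :=
        (norm_le_pi_norm ((v 0 - w) q) j).trans (norm_le_pi_norm (v 0 - w) q)
      have h2 : ‖v 0 - w‖ = K * a := by rw [hK]; field_simp
      calc |(v 0 - w) q j| ≤ K * a := h1.trans_eq h2
        _ ≤ K' * u q j := mul_le_mul hK'.le (hau (q, j)).le ha.le hK0.le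
  have key2 : ∀ q j, |(v t - w) q j| ≤ K * u q j * Real.exp (-(c / 2) * t) := by
    intro q j
    have hcont : Continuous fun K' : ℝ => K' * u q j * Real.exp (-(c / 2) * t) := by fun_prop
    refine ge_of_tendsto (hcont.continuousAt.mono_left (nhdsWithin_le_nhds (s := Set.Ioi K))) ?_
    filter_upwards [self_mem_nhdsWithin] with K' hK' using key K' hK' q j
  have hnn : 0 ≤ ‖u‖ / a * Real.exp (-(c / 2) * t) * ‖v 0 - w‖ := by positivity
  refine (pi_norm_le_iff_of_nonneg hnn).2 fun q => (pi_norm_le_iff_of_nonneg hnn).2 fun j => ?_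
  have h3 : u q j ≤ ‖u‖ :=
    (le_abs_self _).trans ((norm_le_pi_norm (u q) j).trans (norm_le_pi_norm u q))
  calc |(v t - w) q j| ≤ K * u q j * Real.exp (-(c / 2) * t) := key2 q j
    _ ≤ K * ‖u‖ * Real.exp (-(c / 2) * t) := by gcongr
    _ = _ := by rw [hK]; ring

/-! ### Exponential ergodicity of the discrete chain. -/

/-- The Kolmogorov forward operator of the discrete-state Markov chain. -/
noncomputable def forward [Fintype L] [DecidableEq Q] (S : AoISHS Q L n) (d : Q → ℝ) (q : Q) : ℝ :=
  (∑ l with S.dst l = q, S.rate l * d (S.src l)) - S.outRate q * d q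

/-- The Dirichlet form of the discrete-state Markov chain. -/
noncomputable def dirichlet [Fintype L] (S : AoISHS Q L n) (p f : Q → ℝ) : ℝ :=
  ∑ l, S.rate l * p (S.src l) * (f (S.src l) - f (S.dst l)) ^ 2

theorem sum_mul_outRate [Fintype Q] [Fintype L] [DecidableEq Q] (S : AoISHS Q L n) (g : Q → ℝ) :
    ∑ q, g q * S.outRate q = ∑ l, S.rate l * g (S.src l) := by
  rw [← Finset.sum_fiberwise Finset.univ S.src]
  refine Finset.sum_congr rfl fun q _ => ?_
  rw [outRate, Finset.mul_sum]
  refine Finset.sum_congr rfl fun l hl => ?_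
  rw [(Finset.mem_filter.1 hl).2, mul_comm]

theorem sum_mul_sum_dst [Fintype Q] [Fintype L] [DecidableEq Q] (S : AoISHS Q L n) (g : Q → ℝ)
    (h : L → ℝ) : ∑ q, g q * ∑ l with S.dst l = q, h l = ∑ l, g (S.dst l) * h l := by
  rw [← Finset.sum_fiberwise Finset.univ S.dst (fun l => g (S.dst l) * h l)]
  refine Finset.sum_congr rfl fun q _ => ?_
  rw [Finset.mul_sum]
  refine Finset.sum_congr rfl fun l hl => ?_
  rw [(Finset.mem_filter.1 hl).2]

/-- Stationarity allows the outflow term to be summed over transitions either by source or by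
target; using half of each completes the square. Reversibility plays no role. -/
theorem sum_mul_forward [Fintype Q] [Fintype L] [DecidableEq Q] {S : AoISHS Q L n} {p : Q → ℝ}
    (hp : S.IsStationary p) (f : Q → ℝ) :
    ∑ q, 2 * f q * S.forward (fun q => p q * f q) q = -S.dirichlet p f := by
  have h1 : ∑ q, f q ^ 2 * (p q * S.outRate q)
      = ∑ l, f (S.dst l) ^ 2 * (S.rate l * p (S.src l)) := by
    rw [← S.sum_mul_sum_dst fun q => f q ^ 2]
    exact Finset.sum_congr rfl fun q _ => by rw [hp.2.2 q]
  have h2 : ∑ q, f q ^ 2 * (p q * S.outRate q)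
      = ∑ l, S.rate l * (f (S.src l) ^ 2 * p (S.src l)) := by
    rw [← S.sum_mul_outRate fun q => f q ^ 2 * p q]
    exact Finset.sum_congr rfl fun q _ => by ring
  have h3 : ∑ q, f q * ∑ l with S.dst l = q, S.rate l * (p (S.src l) * f (S.src l))
      = ∑ l, f (S.dst l) * (S.rate l * (p (S.src l) * f (S.src l))) := sum_mul_sum_dst _ _ _
  have h4 : ∑ q, 2 * f q * S.forward (fun q => p q * f q) q
      = 2 * (∑ q, f q * ∑ l with S.dst l = q, S.rate l * (p (S.src l) * f (S.src l)))
        - 2 * ∑ q, f q ^ 2 * (p q * S.outRate q) := by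
    rw [Finset.mul_sum, Finset.mul_sum, ← Finset.sum_sub_distrib]
    refine Finset.sum_congr rfl fun q _ => ?_
    simp only [forward]; ring
  have h5 : 2 * ∑ q, f q ^ 2 * (p q * S.outRate q)
      = ∑ l, (f (S.dst l) ^ 2 * (S.rate l * p (S.src l))
        + S.rate l * (f (S.src l) ^ 2 * p (S.src l))) := by
    rw [Finset.sum_add_distrib, ← h1, ← h2, two_mul]
  rw [h4, h5, h3, dirichlet, Finset.mul_sum, ← Finset.sum_sub_distrib, ← Finset.sum_neg_distrib]
  refine Finset.sum_congr rfl fun l _ => ?_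
  ring

theorem dirichlet_nonneg [Fintype L] {S : AoISHS Q L n} {p : Q → ℝ} (hp : ∀ q, 0 ≤ p q)
    (f : Q → ℝ) : 0 ≤ S.dirichlet p f :=
  Finset.sum_nonneg fun l _ => mul_nonneg (mul_nonneg (S.rate_nonneg l) (hp _)) (sq_nonneg _)

/-- The Poincaré inequality of an irreducible finite Markov chain. -/
theorem exists_poincare [Fintype Q] [Fintype L] [DecidableEq Q] {S : AoISHS Q L n}
    (herg : S.Ergodic) {p : Q → ℝ} (hp : S.IsStationary p) :
    ∃ c > 0, ∀ f : Q → ℝ, ∑ q, p q * f q = 0 → c * ∑ q, p q * f q ^ 2 ≤ S.dirichlet p f := by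
  have hpos := hp.pos herg
  -- On this compact unit sphere of mean-zero functions the Dirichlet form attains its minimum. A
  -- zero minimum would force a function constant along transitions, hence constant, hence zero.
  -- Homogeneity extends the bound to all mean-zero functions.
  set T : Set (Q → ℝ) := {f | ∑ q, p q * f q = 0} ∩ {f | ∑ q, p q * f q ^ 2 = 1} with hT
  have hTclosed : IsClosed T :=
    (isClosed_eq (by fun_prop) continuous_const).inter (isClosed_eq (by fun_prop) continuous_const)
  obtain ⟨a, ha, hap⟩ := exists_pos_forall_lt_of_finite hpos
  have hTb : Bornology.IsBounded T := by
    refine (Metric.isBounded_iff_subset_closedBall 0).2 ⟨1 + 1 / a, fun f hf => ?_⟩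
    have hR : 0 ≤ 1 + 1 / a := by positivity
    rw [mem_closedBall_zero_iff, pi_norm_le_iff_of_nonneg hR]
    intro q
    have h1 : p q * f q ^ 2 ≤ 1 := by
      rw [← hf.2]
      exact Finset.single_le_sum (f := fun q => p q * f q ^ 2)
        (fun q _ => mul_nonneg (hpos q).le (sq_nonneg _)) (Finset.mem_univ q)
    have h2 : a * f q ^ 2 ≤ 1 :=
      (mul_le_mul_of_nonneg_right (hap q).le (sq_nonneg _)).trans h1
    have h3 : f q ^ 2 ≤ 1 / a := by rw [le_div_iff₀ ha]; linarith
    rw [Real.norm_eq_abs]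
    refine abs_le_of_sq_le_sq (h3.trans ?_) hR
    have : 0 ≤ 1 / a := by positivity
    nlinarith
  have hcomp : IsCompact T := Metric.isCompact_of_isClosed_isBounded hTclosed hTb
  have hcont : Continuous (S.dirichlet p) := by unfold dirichlet; fun_prop
  have hscale : ∀ c, (∀ f ∈ T, c ≤ S.dirichlet p f) →
      ∀ f : Q → ℝ, ∑ q, p q * f q = 0 → c * ∑ q, p q * f q ^ 2 ≤ S.dirichlet p f := by
    intro c hc f hf
    set v := ∑ q, p q * f q ^ 2 with hv
    have hv0 : 0 ≤ v := Finset.sum_nonneg fun q _ => mul_nonneg (hpos q).le (sq_nonneg _)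
    rcases hv0.eq_or_lt with h | h
    · rw [← h, mul_zero]; exact dirichlet_nonneg hp.1 f
    · have hs : Real.sqrt v ^ 2 = v := Real.sq_sqrt hv0
      have hs0 : 0 < Real.sqrt v := Real.sqrt_pos.2 h
      have hmem : (fun q => f q / Real.sqrt v) ∈ T := by
        constructor
        · simp only [Set.mem_ofPred_eq, ← mul_div_assoc, ← Finset.sum_div, hf, zero_div]
        · simp only [Set.mem_ofPred_eq, div_pow, hs, ← mul_div_assoc, ← Finset.sum_div]
          rw [← hv, div_self h.ne']
      have h1 := hc _ hmem
      have h2 : S.dirichlet p (fun q => f q / Real.sqrt v) = S.dirichlet p f / v := by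
        simp only [dirichlet, Finset.sum_div]
        refine Finset.sum_congr rfl fun l _ => ?_
        rw [← sub_div, div_pow, hs, mul_div_assoc]
      rw [h2, le_div_iff₀ h] at h1
      exact h1
  rcases T.eq_empty_or_nonempty with hemp | hne
  -- With a single state there are no nonzero mean-zero functions, so any constant works.
  · exact ⟨1, one_pos, hscale 1 (by simp [hemp])⟩
  · obtain ⟨g, hg, hmin⟩ := hcomp.exists_isMinOn hne hcont.continuousOn
    refine ⟨S.dirichlet p g, (dirichlet_nonneg hp.1 g).lt_of_ne' fun h0 => ?_,
      hscale _ fun f hf => hmin hf⟩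
    rw [dirichlet, Finset.sum_eq_zero_iff_of_nonneg fun l _ =>
      mul_nonneg (mul_nonneg (S.rate_nonneg l) (hp.1 _)) (sq_nonneg _)] at h0
    have hstep : ∀ a b, S.Step a b → g a = g b := by
      rintro a b ⟨l, rfl, rfl, hl⟩
      have := h0 l (Finset.mem_univ l)
      have h1 := (mul_eq_zero.1 this).resolve_left (mul_pos hl (hpos _)).ne'
      exact sub_eq_zero.1 (pow_eq_zero_iff two_ne_zero |>.1 h1)
    have hconst : ∀ a b, g a = g b := fun a b =>
      Relation.ReflTransGen.head_induction_on (motive := fun a _ => g a = g b) (herg a b) rfl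
        fun h _ ih => (hstep _ _ h).trans ih
    have hz : ∀ a, g a = 0 := by
      intro a
      have h := hg.1
      simp only [Set.mem_ofPred_eq] at h
      rw [Finset.sum_congr rfl fun q _ => by rw [hconst q a], ← Finset.sum_mul, hp.2.1,
        one_mul] at h
      exact h
    have h1 := hg.2
    simp [hz] at h1

/-- Exponential convergence to equilibrium of the discrete-state Markov chain. -/
theorem exists_abs_le_exp_of_forward [Fintype Q] [Fintype L] [DecidableEq Q] {S : AoISHS Q L n}
    (herg : S.Ergodic) {p : Q → ℝ} (hp : S.IsStationary p) {d : ℝ → Q → ℝ}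
    (hd : ContinuousOn d (Set.Ici 0))
    (hd' : ∀ t, 0 ≤ t → HasDerivWithinAt d (S.forward (d t)) (Set.Ici t) t)
    (hsum : ∀ t, 0 ≤ t → ∑ q, d t q = 0) :
    ∃ η > 0, ∃ D, ∀ t, 0 ≤ t → ∀ q, |d t q| ≤ D * Real.exp (-η * t) := by
  have hpos := hp.pos herg
  obtain ⟨c, hc, hpc⟩ := exists_poincare herg hp
  -- This chi-square functional has derivative minus the Dirichlet form of `d / p`. The Poincaré
  -- inequality and Grönwall give decay at rate `c`, so `d` itself decays at rate `c / 2`.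
  set V : ℝ → ℝ := fun t => ∑ q, d t q ^ 2 / p q with hV
  have hVd : ∀ t, 0 ≤ t → HasDerivWithinAt V (-S.dirichlet p fun q => d t q / p q)
      (Set.Ici t) t := by
    intro t ht
    have h1 : HasDerivWithinAt V (∑ q, (2 * d t q * S.forward (d t) q) / p q) (Set.Ici t) t := by
      refine HasDerivWithinAt.fun_sum fun q _ => ?_
      have := ((hasDerivWithinAt_pi.1 (hd' t ht) q).pow 2).div_const (p q)
      simpa using this
    convert! h1 using 1
    rw [← sum_mul_forward hp]
    refine Finset.sum_congr rfl fun q _ => ?_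
    have : (fun q => p q * (d t q / p q)) = d t := by
      funext q; rw [mul_div_cancel₀ _ (hpos q).ne']
    rw [this]; ring
  have hVc : ContinuousOn V (Set.Ici 0) := by
    refine continuousOn_finsetSum _ fun q _ => ?_
    exact ((continuousOn_pi.1 hd q).pow 2).div_const _
  have hVb : ∀ t, 0 ≤ t → V t ≤ V 0 * Real.exp (-c * t) := by
    intro t ht
    have h := le_gronwallBound_of_liminf_deriv_right_le (K := -c) (ε := 0) (δ := V 0)
      (hVc.mono fun s hs => hs.1)
      (fun s hs r hr => (hVd s hs.1).liminf_right_slope_le hr) le_rfl ?_ t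
      (Set.right_mem_Icc.2 ht)
    · rwa [gronwallBound_ε0, sub_zero] at h
    · intro s hs
      have h1 := hpc (fun q => d s q / p q) (by
        rw [← hsum s hs.1]
        exact Finset.sum_congr rfl fun q _ => mul_div_cancel₀ _ (hpos q).ne')
      have h2 : ∑ q, p q * (d s q / p q) ^ 2 = V s := by
        refine Finset.sum_congr rfl fun q _ => ?_
        have := (hpos q).ne'
        field_simp
      rw [h2] at h1
      linarith
  refine ⟨c / 2, half_pos hc, Real.sqrt (V 0), fun t ht q => ?_⟩
  have hV0 : 0 ≤ V 0 := Finset.sum_nonneg fun q _ => div_nonneg (sq_nonneg _) (hpos q).le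
  refine abs_le_of_sq_le_sq ?_ (by positivity)
  rw [mul_pow, Real.sq_sqrt hV0, ← Real.exp_nat_mul]
  have h1 : d t q ^ 2 / p q ≤ V t :=
    Finset.single_le_sum (f := fun q => d t q ^ 2 / p q)
      (fun q _ => div_nonneg (sq_nonneg _) (hpos q).le) (Finset.mem_univ q)
  have h2 : p q ≤ 1 := by
    rw [← hp.2.1]
    exact Finset.single_le_sum (fun q _ => (hpos q).le) (Finset.mem_univ q)
  have h3 : d t q ^ 2 ≤ V t := (le_div_self (sq_nonneg _) (hpos q) h2).trans h1
  refine h3.trans ((hVb t ht).trans_eq ?_)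
  congr 2
  push_cast
  ring

/-! ### Deterministic analysis of sample paths. -/

theorem norm_vecMul_A_le (S : AoISHS Q L n) (l : L) (v : Fin (n + 1) → ℝ) :
    ‖v ᵥ* S.A l‖ ≤ (n + 1) * ‖v‖ := by
  refine (pi_norm_le_iff_of_nonneg (by positivity)).2 fun j => ?_
  refine (S.abs_vecMul_A_le l (u := fun _ => ‖v‖) (fun i => norm_le_pi_norm v i) j).trans ?_
  simp only [Matrix.vecMul, dotProduct]
  refine (Finset.sum_le_card_nsmul _ _ ‖v‖ fun i _ => ?_).trans_eq (by simp)
  refine mul_le_of_le_one_right (norm_nonneg _) ?_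
  rcases S.A_binary l i j with h | h <;> simp [h]

theorem norm_b_le (S : AoISHS Q L n) (q : Q) : ‖S.b q‖ ≤ 1 := by
  refine (pi_norm_le_iff_of_nonneg zero_le_one).2 fun j => ?_
  rcases S.b_binary q j with h | h <;> simp [h]

theorem norm_smul_b_le (S : AoISHS Q L n) (q : Q) {a : ℝ} (ha : 0 ≤ a) : ‖a • S.b q‖ ≤ a := by
  rw [norm_smul, Real.norm_of_nonneg ha]
  exact mul_le_of_le_one_right ha (S.norm_b_le q)

namespace IsPath

variable [Fintype L] {S : AoISHS Q L n} {N : L → ℝ≥0 → ℕ} {q : ℝ≥0 → Q}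
  {x : ℝ≥0 → Fin (n + 1) → ℝ}

theorem total_mono (h : S.IsPath N q x) : Monotone fun t => ∑ l, N l t :=
  fun _ _ hst => Finset.sum_le_sum fun l _ => h.count_mono l hst

theorem count_eq_of_total_eq (h : S.IsPath N q x) {s t : ℝ≥0} (hst : s ≤ t)
    (ht : ∑ l, N l t = ∑ l, N l s) (k : L) : N k t = N k s :=
  ((Finset.sum_eq_sum_iff_of_le fun l _ => h.count_mono l hst).1 ht.symm k
    (Finset.mem_univ k)).symm

theorem exists_gt_count_eq (h : S.IsPath N q x) (t : ℝ≥0) : ∃ u, t < u ∧ ∀ k, N k u = N k t := by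
  have hev : ∀ᶠ u in 𝓝[>] t, ∀ k, N k u = N k t := by
    refine eventually_all.2 fun k => ?_
    obtain ⟨u, hu, hk⟩ := h.count_right k t
    filter_upwards [Ioo_mem_nhdsGT hu] with r hr
    exact le_antisymm (hk ▸ h.count_mono k hr.2.le) (h.count_mono k hr.1.le)
  obtain ⟨u, hu, hu'⟩ := (hev.and self_mem_nhdsWithin).exists
  exact ⟨u, hu', hu⟩

/-- The jump time is the infimum of the times at which the total count exceeds its value at `s`.
Right-continuity makes the infimum attained, and simplicity makes the increment exactly one. This
drives all inductions on the number of jumps. -/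
theorem exists_first_jump (h : S.IsPath N q x) {s t : ℝ≥0} (hst : s ≤ t)
    (hlt : ∑ l, N l s < ∑ l, N l t) :
    ∃ τ l, s < τ ∧ τ ≤ t ∧ (∀ r, s ≤ r → r < τ → ∀ k, N k r = N k s) ∧
      N l τ = N l s + 1 ∧ (∀ k, k ≠ l → N k τ = N k s) ∧ ∑ k, N k τ = ∑ k, N k s + 1 := by
  classical
  set J : Set ℝ≥0 := {r | s ≤ r ∧ ∑ l, N l s < ∑ l, N l r} with hJ
  have htJ : t ∈ J := ⟨hst, hlt⟩
  set τ := sInf J with hτ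
  have hτt : τ ≤ t := csInf_le (OrderBot.bddBelow _) htJ
  have hsτ' : s ≤ τ := le_csInf ⟨t, htJ⟩ fun r hr => hr.1
  have hbefore : ∀ r, s ≤ r → r < τ → ∑ l, N l r = ∑ l, N l s := by
    intro r hsr hr
    have : r ∉ J := fun hrJ => (csInf_le (OrderBot.bddBelow _) hrJ).not_gt hr
    exact le_antisymm (not_lt.1 fun hh => this ⟨hsr, hh⟩) (h.total_mono hsr)
  have hgt : ∑ l, N l s < ∑ l, N l τ := by
    obtain ⟨u, hu, huN⟩ := h.exists_gt_count_eq τ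
    obtain ⟨r, hr, hru⟩ := exists_lt_of_csInf_lt ⟨t, htJ⟩ hu
    refine hr.2.trans_le ((h.total_mono hru.le).trans_eq ?_)
    exact Finset.sum_congr rfl fun k _ => huN k
  have hsτ : s < τ := hsτ'.lt_of_ne fun he => by rw [← he] at hgt; exact lt_irrefl _ hgt
  -- Simplicity compares `τ` with an unspecified earlier time; replacing it by its maximum with `s`
  -- puts it where the total is still the initial one.
  have htot : ∑ k, N k τ = ∑ k, N k s + 1 := by
    obtain ⟨s', hs', hle⟩ := h.count_simple τ (bot_le.trans_lt hsτ)
    have h1 : ∑ l, N l s' ≤ ∑ l, N l (max s' s) := h.total_mono (le_max_left _ _)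
    rw [hbefore _ (le_max_right _ _) (max_lt hs' hsτ)] at h1
    omega
  obtain ⟨l, -, hl⟩ := Finset.exists_lt_of_sum_lt hgt
  have e1 := Finset.add_sum_erase Finset.univ (fun k => N k τ) (Finset.mem_univ l)
  have e2 := Finset.add_sum_erase Finset.univ (fun k => N k s) (Finset.mem_univ l)
  have hle : ∀ k ∈ Finset.univ.erase l, N k s ≤ N k τ := fun k _ => h.count_mono k hsτ.le
  have e3 := Finset.sum_le_sum hle
  refine ⟨τ, l, hsτ, hτt,
    fun r hsr hr => h.count_eq_of_total_eq hsr (hbefore r hsr hr), by omega, fun k hk => ?_, htot⟩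
  exact ((Finset.sum_eq_sum_iff_of_le hle).1 (by omega) k
    (Finset.mem_erase.2 ⟨hk, Finset.mem_univ k⟩)).symm

theorem flow_of_total_eq (h : S.IsPath N q x) {s t : ℝ≥0} (hst : s ≤ t)
    (ht : ∑ l, N l t = ∑ l, N l s) : q t = q s ∧ x t = x s + ((t : ℝ) - s) • S.b (q s) :=
  h.flow s t hst (h.count_eq_of_total_eq hst ht)

/-- Slopes have norm at most one, and each reset enlarges the norm at most by the factor `n + 1`. -/
theorem norm_le (h : S.IsPath N q x) {s t : ℝ≥0} (hst : s ≤ t) {D : ℕ}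
    (hD : ∑ l, N l t = ∑ l, N l s + D) :
    ‖x t‖ ≤ ((n : ℝ) + 1) ^ D * (‖x s‖ + ((t : ℝ) - s)) := by
  induction D generalizing s with
  | zero =>
    have hst' : (s : ℝ) ≤ t := hst
    rw [(h.flow_of_total_eq hst hD).2, pow_zero, one_mul]
    exact (norm_add_le _ _).trans
      (add_le_add le_rfl (S.norm_smul_b_le _ (sub_nonneg.2 hst')))
  | succ D ih =>
    obtain ⟨τ, l, hsτ, hτt, hb, hl, -, htot⟩ := h.exists_first_jump hst (by omega)
    have h1 := ih hτt (by omega)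
    have h2 := (h.jump s τ l hsτ hb hl).2.2
    have hsτ' : (s : ℝ) ≤ τ := hsτ.le
    have hτt' : (τ : ℝ) ≤ t := hτt
    have h3 : ‖x τ‖ ≤ (n + 1) * (‖x s‖ + ((τ : ℝ) - s)) := by
      rw [h2]
      refine (S.norm_vecMul_A_le l _).trans (mul_le_mul_of_nonneg_left ?_ (by positivity))
      exact (norm_add_le _ _).trans
        (add_le_add le_rfl (S.norm_smul_b_le _ (sub_nonneg.2 hsτ')))
    have hn : (0 : ℝ) ≤ n := n.cast_nonneg
    calc ‖x t‖ ≤ ((n : ℝ) + 1) ^ D * (‖x τ‖ + ((t : ℝ) - τ)) := h1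
      _ ≤ ((n : ℝ) + 1) ^ D * ((n + 1) * (‖x s‖ + ((t : ℝ) - s))) := by
          refine mul_le_mul_of_nonneg_left ?_ (by positivity)
          have : 0 ≤ n * ((t : ℝ) - τ) := mul_nonneg hn (sub_nonneg.2 hτt')
          linarith
      _ = _ := by ring

theorem exists_jump_of_total_eq_succ (h : S.IsPath N q x) {s t : ℝ≥0} (hst : s ≤ t)
    (hD : ∑ l, N l t = ∑ l, N l s + 1) :
    ∃ l, N l t = N l s + 1 ∧ (∀ k, k ≠ l → N k t = N k s) ∧ q s = S.src l ∧ q t = S.dst l ∧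
      ‖x t - x s ᵥ* S.A l‖ ≤ (n + 1) * ((t : ℝ) - s) := by
  obtain ⟨τ, l, hsτ, hτt, hb, hl, hk, htot⟩ := h.exists_first_jump hst (by omega)
  have hst' := h.flow_of_total_eq hτt (by omega)
  have hc := h.count_eq_of_total_eq hτt (by omega)
  obtain ⟨h1, h2, h3⟩ := h.jump s τ l hsτ hb hl
  refine ⟨l, by rw [hc, hl], fun k hkl => by rw [hc, hk k hkl], h1, hst'.1.trans h2, ?_⟩
  have e : x t - x s ᵥ* S.A l
      = (((τ : ℝ) - s) • S.b (S.src l)) ᵥ* S.A l + ((t : ℝ) - τ) • S.b (q τ) := by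
    rw [hst'.2, h3, Matrix.add_vecMul]; abel
  have hsτ' : (s : ℝ) ≤ τ := hsτ.le
  have hτt' : (τ : ℝ) ≤ t := hτt
  have hn : (0 : ℝ) ≤ n := n.cast_nonneg
  rw [e]
  calc _ ≤ (n + 1) * ((τ : ℝ) - s) + ((t : ℝ) - τ) := by
        refine (norm_add_le _ _).trans (add_le_add ?_ (S.norm_smul_b_le _ (sub_nonneg.2 hτt')))
        refine (S.norm_vecMul_A_le l _).trans (mul_le_mul_of_nonneg_left ?_ (by positivity))
        exact S.norm_smul_b_le _ (sub_nonneg.2 hsτ')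
    _ ≤ _ := by
        have : 0 ≤ n * ((t : ℝ) - τ) := mul_nonneg hn (sub_nonneg.2 hτt')
        linarith

/-- The path of `q` is piecewise constant with finitely many pieces. Integrability is what makes the
compensator additive over intervals. -/
theorem intervalIntegrable_comp (h : S.IsPath N q x) (f : Q → ℝ) {s t : ℝ≥0} (hst : s ≤ t) :
    IntervalIntegrable (fun u : ℝ => f (q u.toNNReal)) volume s t := by
  obtain ⟨D, hD⟩ := Nat.exists_eq_add_of_le (h.total_mono hst)
  induction D generalizing s with
  | zero =>
    refine (intervalIntegrable_const (c := f (q s))).congr fun u hu => ?_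
    rw [Set.uIoc_of_le (by exact_mod_cast hst)] at hu
    have hsu : s ≤ u.toNNReal := NNReal.le_toNNReal_of_coe_le hu.1.le
    have hut : u.toNNReal ≤ t := Real.toNNReal_le_iff_le_coe.2 hu.2
    have h1 : ∑ l, N l u.toNNReal = ∑ l, N l s :=
      le_antisymm ((h.total_mono hut).trans_eq hD) (h.total_mono hsu)
    simp only [(h.flow_of_total_eq hsu h1).1]
  | succ D ih =>
    simp only at hD
    obtain ⟨τ, l, hsτ, hτt, hb, -, -, htot⟩ := h.exists_first_jump hst (by omega)
    refine IntervalIntegrable.trans ?_ (ih hτt (by simp only; omega))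
    refine (intervalIntegrable_const (c := f (q s))).congr_uIoo fun u hu => ?_
    rw [Set.uIoo_of_le (by exact_mod_cast hsτ.le)] at hu
    have hsu : s ≤ u.toNNReal := NNReal.le_toNNReal_of_coe_le hu.1.le
    have huτ : u.toNNReal < τ := (Real.toNNReal_lt_iff_lt_coe (s.2.trans hu.1.le)).2 hu.2
    simp only [(h.flow s _ hsu (hb _ hsu huτ)).1]

/-- On a bounded time interval the jumps are separated. -/
theorem exists_pos_total_le_succ (h : S.IsPath N q x) (T : ℝ≥0) :
    ∃ δ : ℝ, 0 < δ ∧ ∀ r r' : ℝ≥0, r ≤ r' → r' ≤ T → (r' : ℝ) - r < δ →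
      ∑ l, N l r' ≤ ∑ l, N l r + 1 := by
  -- Simplicity on the left and right-continuity on the right give each time a neighbourhood with at
  -- most one jump; a Lebesgue number of this cover of `[0, T]` is the required separation.
  have hloc : ∀ t : ℝ≥0, ∃ U : Set ℝ≥0, IsOpen U ∧ t ∈ U ∧ ∀ r ∈ U, ∀ r' ∈ U,
      ∑ l, N l r' ≤ ∑ l, N l r + 1 := by
    intro t
    obtain ⟨u, hu, hu'⟩ := h.exists_gt_count_eq t
    have hut : ∑ l, N l u = ∑ l, N l t := Finset.sum_congr rfl fun k _ => hu' k
    rcases (zero_le (a := t)).eq_or_lt with h0 | h0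
    · refine ⟨Set.Iio u, isOpen_Iio, hu, fun r _ r' hr' => ?_⟩
      have h1 : ∑ l, N l r' ≤ ∑ l, N l u := h.total_mono (le_of_lt hr')
      have h2 : ∑ l, N l t ≤ ∑ l, N l r := h.total_mono (h0 ▸ zero_le)
      omega
    · obtain ⟨s, hs, hs'⟩ := h.count_simple t h0
      refine ⟨Set.Ioo s u, isOpen_Ioo, ⟨hs, hu⟩, fun r hr r' hr' => ?_⟩
      have h1 : ∑ l, N l r' ≤ ∑ l, N l u := h.total_mono hr'.2.le
      have h2 : ∑ l, N l s ≤ ∑ l, N l r := h.total_mono hr.1.le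
      omega
  choose U hUo hUt hU using hloc
  obtain ⟨δ, hδ, hball⟩ := lebesgue_number_lemma_of_metric (isCompact_Icc (a := (0 : ℝ≥0)) (b := T))
    hUo fun t _ => Set.mem_iUnion.2 ⟨t, hUt t⟩
  refine ⟨δ, hδ, fun r r' hrr' hr'T hd => ?_⟩
  obtain ⟨i, hi⟩ := hball r ⟨zero_le, hrr'.trans hr'T⟩
  refine hU i r (hi (Metric.mem_ball_self hδ)) r' (hi ?_)
  rw [Metric.mem_ball, NNReal.dist_eq, abs_of_nonneg (sub_nonneg.2 (NNReal.coe_le_coe.2 hrr'))]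
  exact hd

end IsPath

/-! ### Compensators along a path. -/

open Classical in
/-- The compensator of the counting process of the transition `l` along the path `q`. -/
noncomputable def compensator (S : AoISHS Q L n) (l : L) (q : ℝ≥0 → Q) (t : ℝ≥0) : ℝ :=
  ∫ u in (0 : ℝ)..t, S.rate l * (if q u.toNNReal = S.src l then 1 else 0)

/-- The number of transitions in `(s, t]`. -/
def jumps [Fintype L] (N : L → ℝ≥0 → ℕ) (s t : ℝ≥0) : ℕ := ∑ l, (N l t - N l s)

theorem abs_compensator_le (S : AoISHS Q L n) (l : L) (q : ℝ≥0 → Q) (t : ℝ≥0) :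
    |S.compensator l q t| ≤ S.rate l * t := by
  have h := intervalIntegral.norm_integral_le_of_norm_le_const (a := 0) (b := t) (C := S.rate l)
    (f := fun u : ℝ => S.rate l * (open Classical in if q u.toNNReal = S.src l then 1 else 0))
    fun u _ => by
      rw [norm_mul, Real.norm_of_nonneg (S.rate_nonneg l)]
      refine mul_le_of_le_one_right (S.rate_nonneg l) ?_
      split_ifs <;> simp
  simpa [compensator] using h

namespace IsPath

variable [Fintype L] {S : AoISHS Q L n} {N : L → ℝ≥0 → ℕ} {q : ℝ≥0 → Q}
  {x : ℝ≥0 → Fin (n + 1) → ℝ}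

theorem total_eq_add_jumps (h : S.IsPath N q x) {s t : ℝ≥0} (hst : s ≤ t) :
    ∑ l, N l t = ∑ l, N l s + jumps N s t := by
  rw [jumps, ← Finset.sum_add_distrib]
  exact Finset.sum_congr rfl fun l _ => (Nat.add_sub_cancel' (h.count_mono l hst)).symm

open Classical in
theorem compensator_sub (h : S.IsPath N q x) (l : L) (s t : ℝ≥0) :
    S.compensator l q t - S.compensator l q s =
      ∫ u in (s : ℝ)..t, S.rate l * (if q u.toNNReal = S.src l then 1 else 0) := by
  have hi : ∀ t, IntervalIntegrable (fun u : ℝ => S.rate l *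
      (if q u.toNNReal = S.src l then (1 : ℝ) else 0)) volume 0 (t : ℝ≥0) := fun t => by
    have := h.intervalIntegrable_comp (fun a => S.rate l * if a = S.src l then (1 : ℝ) else 0)
      (zero_le (a := t))
    simpa using this
  exact intervalIntegral.integral_interval_sub_left (hi t) (hi s)

theorem compensator_sub_mem (h : S.IsPath N q x) (l : L) {s t : ℝ≥0} (hst : s ≤ t) :
    S.compensator l q t - S.compensator l q s ∈ Set.Icc 0 (S.rate l * ((t : ℝ) - s)) := by
  classical
  rw [h.compensator_sub l s t]
  have hst' : (s : ℝ) ≤ t := hst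
  have hr := S.rate_nonneg l
  constructor
  · refine intervalIntegral.integral_nonneg hst' fun u _ => mul_nonneg hr ?_
    split_ifs <;> simp
  · refine (le_abs_self _).trans ?_
    have := intervalIntegral.norm_integral_le_of_norm_le_const (a := (s : ℝ)) (b := t)
      (C := S.rate l)
      (f := fun u : ℝ => S.rate l * (if q u.toNNReal = S.src l then 1 else 0)) fun u _ => by
        rw [norm_mul, Real.norm_of_nonneg hr]
        refine mul_le_of_le_one_right hr ?_
        split_ifs <;> simp
    rwa [abs_of_nonneg (sub_nonneg.2 hst')] at this

open Classical in
theorem abs_compensator_sub_sub_le (h : S.IsPath N q x) (l : L) {s t : ℝ≥0} (hst : s ≤ t) :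
    |S.compensator l q t - S.compensator l q s
        - S.rate l * ((t : ℝ) - s) * (if q s = S.src l then 1 else 0)|
      ≤ S.rate l * ((t : ℝ) - s) * jumps N s t := by
  have hst' : (s : ℝ) ≤ t := hst
  have hr := mul_nonneg (S.rate_nonneg l) (sub_nonneg.2 hst')
  -- Without a jump the frozen intensity is exact. Otherwise both quantities lie between `0` and
  -- `rate * (t - s)`, and the factor `jumps` is at least one.
  rcases Nat.eq_zero_or_pos (jumps N s t) with h0 | h0
  · have hD := h.total_eq_add_jumps hst
    rw [h0, add_zero] at hD
    have e : ∫ u in (s : ℝ)..t, S.rate l * (if q u.toNNReal = S.src l then (1 : ℝ) else 0)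
        = ∫ u in (s : ℝ)..t, S.rate l * (if q s = S.src l then (1 : ℝ) else 0) := by
      refine intervalIntegral.integral_congr fun u hu => ?_
      rw [Set.uIcc_of_le hst'] at hu
      have hsu : s ≤ u.toNNReal := NNReal.le_toNNReal_of_coe_le hu.1
      have hut : u.toNNReal ≤ t := Real.toNNReal_le_iff_le_coe.2 hu.2
      have h1 : ∑ l, N l u.toNNReal = ∑ l, N l s :=
        le_antisymm ((h.total_mono hut).trans_eq hD) (h.total_mono hsu)
      simp only [(h.flow_of_total_eq hsu h1).1]
    rw [h.compensator_sub l s t, e, intervalIntegral.integral_const, h0, smul_eq_mul]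
    rw [show ((t : ℝ) - s) * (S.rate l * (if q s = S.src l then (1 : ℝ) else 0))
      - S.rate l * ((t : ℝ) - s) * (if q s = S.src l then 1 else 0) = 0 by ring]
    simp
  · have h1 : (1 : ℝ) ≤ jumps N s t := by exact_mod_cast h0
    have h2 := h.compensator_sub_mem l hst
    refine le_trans ?_ (le_mul_of_one_le_right hr h1)
    rw [abs_le]
    constructor <;> split_ifs <;> linarith [h2.1, h2.2]

end IsPath

/-! ### Martingale estimates and exponential moments of the jump counts. -/

namespace IsRealization

variable [Fintype L] {S : AoISHS Q L n} {Ω : Type*} [mΩ : MeasurableSpace Ω] {μ : Measure Ω}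
  {ℱ : Filtration ℝ≥0 mΩ} {N : L → ℝ≥0 → Ω → ℕ} {q : ℝ≥0 → Ω → Q}
  {x : ℝ≥0 → Ω → Fin (n + 1) → ℝ}

theorem martingale (h : S.IsRealization μ ℱ N q x) (l : L) :
    Martingale (fun t ω => (N l t ω : ℝ) - S.compensator l (fun t => q t ω) t) ℱ μ :=
  h.intensity l

theorem measurable_count (h : S.IsRealization μ ℱ N q x) (l : L) {s t : ℝ≥0} (hst : s ≤ t) :
    Measurable[ℱ t] (N l s) :=
  (h.count_adapted l s).mono (ℱ.mono hst) le_rfl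

theorem ae_count_mono (h : S.IsRealization μ ℱ N q x) (l : L) {s t : ℝ≥0} (hst : s ≤ t) :
    ∀ᵐ ω ∂μ, N l s ω ≤ N l t ω := by
  filter_upwards [h.path] with ω hω using hω.count_mono l hst

theorem measurable_jumps (h : S.IsRealization μ ℱ N q x) {s t : ℝ≥0} (hst : s ≤ t) :
    Measurable[ℱ t] fun ω => jumps (fun l t => N l t ω) s t :=
  Finset.measurable_fun_sum _ fun l _ => (h.measurable_count l le_rfl).sub (h.measurable_count l hst)

variable [IsProbabilityMeasure μ]

theorem integrable_compensator (h : S.IsRealization μ ℱ N q x) (l : L) (t : ℝ≥0) :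
    Integrable (fun ω => S.compensator l (fun t => q t ω) t) μ := by
  have h1 : Measurable fun ω => (N l t ω : ℝ) :=
    measurable_from_top.comp ((h.count_adapted l t).mono (ℱ.le t) le_rfl)
  have h2 := ((h.martingale l).1 t).mono (ℱ.le t)
  -- Joint measurability of `q` in time and `ω` is not assumed; measurability of the compensator is
  -- read off as the count minus the martingale.
  have h3 : StronglyMeasurable fun ω => S.compensator l (fun t => q t ω) t := by
    have h4 : (fun ω => S.compensator l (fun t => q t ω) t) = (fun ω => (N l t ω : ℝ))
        - fun ω => (N l t ω : ℝ) - S.compensator l (fun t => q t ω) t := by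
      funext ω; simp
    rw [h4]
    exact h1.stronglyMeasurable.sub h2
  exact (integrable_const (S.rate l * t)).mono' h3.aestronglyMeasurable
    (ae_of_all _ fun ω => S.abs_compensator_le l _ t)

theorem integrable_count (h : S.IsRealization μ ℱ N q x) (l : L) (t : ℝ≥0) :
    Integrable (fun ω => (N l t ω : ℝ)) μ := by
  refine (((h.martingale l).integrable t).add (h.integrable_compensator l t)).congr
    (ae_of_all _ fun ω => ?_)
  simp

theorem integral_mul_count_sub (h : S.IsRealization μ ℱ N q x) (l : L) {s t : ℝ≥0} (hst : s ≤ t)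
    {Z : Ω → ℝ} (hZ : StronglyMeasurable[ℱ s] Z) (hZi : Integrable Z μ)
    (hZN : Integrable (fun ω => Z ω * ((N l t ω : ℝ) - N l s ω)) μ) :
    ∫ ω, Z ω * ((N l t ω : ℝ) - N l s ω) ∂μ =
      ∫ ω, Z ω * (S.compensator l (fun t => q t ω) t - S.compensator l (fun t => q t ω) s) ∂μ := by
  set c : ℝ≥0 → Ω → ℝ := fun t ω => S.compensator l (fun t => q t ω) t with hc
  have hZc : Integrable (fun ω => Z ω * (c t ω - c s ω)) μ := by
    refine hZi.mul_bdd (c := S.rate l * t + S.rate l * s)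
      ((h.integrable_compensator l t).sub (h.integrable_compensator l s)).1
      (ae_of_all _ fun ω => ?_)
    exact (abs_sub _ _).trans (add_le_add (S.abs_compensator_le l _ t) (S.abs_compensator_le l _ s))
  set M : ℝ≥0 → Ω → ℝ := fun t ω => (N l t ω : ℝ) - c t ω with hM
  have hMi : ∀ t, Integrable (M t) μ := (h.martingale l).integrable
  have hZM : Integrable (Z * (M t - M s)) μ := by
    refine (hZN.sub hZc).congr (ae_of_all _ fun ω => ?_)
    simp only [hM, Pi.sub_apply, Pi.mul_apply]; ring
  have h1 : μ[M t - M s | ℱ s] =ᵐ[μ] 0 := by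
    have h2 := condExp_sub (hMi t) (hMi s) (ℱ s)
    have h3 := (h.martingale l).2 s t hst
    have h4 := (h.martingale l).2 s s le_rfl
    filter_upwards [h2, h3, h4] with ω h2 h3 h4
    rw [h2, Pi.sub_apply]
    exact sub_eq_zero.2 (h3.trans h4.symm)
  have h2 := condExp_mul_of_stronglyMeasurable_left hZ hZM ((hMi t).sub (hMi s))
  have h3 : ∫ ω, (Z * (M t - M s)) ω ∂μ = 0 := by
    rw [← integral_condExp (ℱ.le s), integral_congr_ae h2]
    refine integral_eq_zero_of_ae ?_
    filter_upwards [h1] with ω h1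
    simp [h1]
  rw [← sub_eq_zero, ← integral_sub hZN hZc, ← h3]
  congr 1
  funext ω
  simp only [hM, Pi.sub_apply, Pi.mul_apply]; ring

/-- The martingale property on sets of `ℱ s` compares two measures on that σ-algebra: the one with
density the increment, and a multiple of `μ`. Integrating against both handles arbitrary
non-negative `Z`, with no integrability of the product to check. -/
theorem lintegral_mul_count_sub_le (h : S.IsRealization μ ℱ N q x) (l : L) {s t : ℝ≥0}
    (hst : s ≤ t) {Z : Ω → ENNReal} (hZ : Measurable[ℱ s] Z) :
    ∫⁻ ω, Z ω * (N l t ω - N l s ω : ℕ) ∂μ ≤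
      ENNReal.ofReal (S.rate l * ((t : ℝ) - s)) * ∫⁻ ω, Z ω ∂μ := by
  set g : Ω → ENNReal := fun ω => ((N l t ω - N l s ω : ℕ) : ENNReal) with hg
  have hgm : Measurable g := by
    have h1 : Measurable (N l t) := (h.count_adapted l t).mono (ℱ.le t) le_rfl
    have h2 : Measurable (N l s) := (h.count_adapted l s).mono (ℱ.le s) le_rfl
    exact measurable_from_top.comp (h1.sub h2)
  have hle : (μ.withDensity g).trim (ℱ.le s) ≤
      ENNReal.ofReal (S.rate l * ((t : ℝ) - s)) • μ.trim (ℱ.le s) := by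
    refine @Measure.le_intro Ω (ℱ s) _ _ fun A hA _ => ?_
    have hA' := ℱ.le s A hA
    rw [trim_measurableSet_eq _ hA, Measure.smul_apply, trim_measurableSet_eq _ hA,
      withDensity_apply _ hA', smul_eq_mul]
    set c : ℝ≥0 → Ω → ℝ := fun t ω => S.compensator l (fun t => q t ω) t with hc
    have e1 : ∫⁻ ω in A, g ω ∂μ = ENNReal.ofReal (∫ ω in A, ((N l t ω : ℝ) - N l s ω) ∂μ) := by
      rw [ofReal_integral_eq_lintegral_ofReal (f := fun ω => (N l t ω : ℝ) - N l s ω)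
        ((h.integrable_count l t).sub (h.integrable_count l s)).integrableOn]
      · refine lintegral_congr_ae (ae_restrict_of_ae ?_)
        filter_upwards [h.ae_count_mono l hst] with ω hω
        rw [hg, ← Nat.cast_sub hω, ENNReal.ofReal_natCast]
      · refine ae_restrict_of_ae ?_
        filter_upwards [h.ae_count_mono l hst] with ω hω
        simpa using hω
    have e2 : ∫ ω in A, ((N l t ω : ℝ) - N l s ω) ∂μ = ∫ ω in A, (c t ω - c s ω) ∂μ := by
      have := (h.martingale l).setIntegral_eq hst hA
      rw [integral_sub (h.integrable_count l s).integrableOn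
          (h.integrable_compensator l s).integrableOn,
        integral_sub (h.integrable_count l t).integrableOn
          (h.integrable_compensator l t).integrableOn] at this
      rw [integral_sub (h.integrable_count l t).integrableOn
          (h.integrable_count l s).integrableOn,
        integral_sub (h.integrable_compensator l t).integrableOn
          (h.integrable_compensator l s).integrableOn]
      linarith
    have e3 : ∫ ω in A, (c t ω - c s ω) ∂μ ≤ ∫ _ in A, S.rate l * ((t : ℝ) - s) ∂μ := by
      refine integral_mono_ae ((h.integrable_compensator l t).sub
        (h.integrable_compensator l s)).integrableOn (integrable_const _) (ae_restrict_of_ae ?_)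
      filter_upwards [h.path] with ω hω using (hω.compensator_sub_mem l hst).2
    rw [e1, e2]
    refine (ENNReal.ofReal_le_ofReal e3).trans_eq ?_
    rw [setIntegral_const, smul_eq_mul, mul_comm,
      ENNReal.ofReal_mul (mul_nonneg (S.rate_nonneg l) (sub_nonneg.2 (NNReal.coe_le_coe.2 hst))),
      ofReal_measureReal]
  calc ∫⁻ ω, Z ω * g ω ∂μ = ∫⁻ ω, Z ω ∂(μ.withDensity g) := by
        rw [lintegral_withDensity_eq_lintegral_mul _ hgm (hZ.mono (ℱ.le s) le_rfl)]
        simp only [Pi.mul_apply, mul_comm]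
    _ = ∫⁻ ω, Z ω ∂((μ.withDensity g).trim (ℱ.le s)) := (lintegral_trim _ hZ).symm
    _ ≤ ∫⁻ ω, Z ω ∂(ENNReal.ofReal (S.rate l * ((t : ℝ) - s)) • μ.trim (ℱ.le s)) :=
        lintegral_mono' hle le_rfl
    _ = _ := by rw [lintegral_smul_measure, lintegral_trim _ hZ, smul_eq_mul]

/-- The total rate of all transitions. -/
noncomputable def _root_.AoISHS.totalRate (S : AoISHS Q L n) : ℝ := ∑ l, S.rate l

theorem _root_.AoISHS.totalRate_nonneg (S : AoISHS Q L n) : 0 ≤ S.totalRate :=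
  Finset.sum_nonneg fun l _ => S.rate_nonneg l

theorem lintegral_mul_jumps_le (h : S.IsRealization μ ℱ N q x) {s t : ℝ≥0}
    (hst : s ≤ t) {Z : Ω → ENNReal} (hZ : Measurable[ℱ s] Z) :
    ∫⁻ ω, Z ω * jumps (fun l t => N l t ω) s t ∂μ ≤
      ENNReal.ofReal (S.totalRate * ((t : ℝ) - s)) * ∫⁻ ω, Z ω ∂μ := by
  have hst' : 0 ≤ (t : ℝ) - s := sub_nonneg.2 (NNReal.coe_le_coe.2 hst)
  simp only [jumps, Nat.cast_sum, Finset.mul_sum]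
  rw [lintegral_finsetSum, totalRate, Finset.sum_mul, ENNReal.ofReal_sum_of_nonneg
    fun l _ => mul_nonneg (S.rate_nonneg l) hst', Finset.sum_mul]
  · exact Finset.sum_le_sum fun l _ => h.lintegral_mul_count_sub_le l hst hZ
  · intro l _
    refine (hZ.mono (ℱ.le s) le_rfl).mul (measurable_from_top.comp ?_)
    exact ((h.count_adapted l t).mono (ℱ.le t) le_rfl).sub
      ((h.count_adapted l s).mono (ℱ.le s) le_rfl)

/-- The partial product is known at the start of the next cell, so it can serve as the weight `Z`
there; each cell then costs a factor `1 + a * totalRate * d`. -/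
theorem lintegral_mul_prod_le (h : S.IsRealization μ ℱ N q x) (a : ℝ≥0) (s d : ℝ≥0)
    {Z : Ω → ENNReal} (hZ : Measurable[ℱ s] Z) (m : ℕ) :
    ∫⁻ ω, Z ω * ∏ i ∈ Finset.range m,
        (1 + a * (jumps (fun l t => N l t ω) (s + i * d) (s + (i + 1 : ℕ) * d) : ENNReal)) ∂μ ≤
      ENNReal.ofReal (1 + a * (S.totalRate * d)) ^ m * ∫⁻ ω, Z ω ∂μ := by
  have hmono : Monotone fun i : ℕ => s + i * d := fun i j hij => by dsimp only; gcongr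
  set P : ℕ → Ω → ENNReal := fun m ω => Z ω * ∏ i ∈ Finset.range m,
    (1 + a * (jumps (fun l t => N l t ω) (s + i * d) (s + (i + 1 : ℕ) * d) : ENNReal)) with hP
  have hPm : ∀ m : ℕ, Measurable[ℱ (s + m * d)] (P m) := by
    intro m
    refine (hZ.mono (ℱ.mono (by simp)) le_rfl).mul (Finset.measurable_fun_prod _ fun i hi => ?_)
    have hi' : s + (i + 1 : ℕ) * d ≤ s + m * d :=
      hmono (Nat.succ_le_of_lt (Finset.mem_range.1 hi))
    refine Measurable.const_add (Measurable.const_mul (measurable_from_top.comp ?_) _) _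
    exact (h.measurable_jumps (hmono (Nat.le_succ i))).mono (ℱ.mono hi') le_rfl
  induction m with
  | zero => simp
  | succ m ih =>
    have e : ∀ ω, P (m + 1) ω = P m ω + a * (P m ω *
        (jumps (fun l t => N l t ω) (s + m * d) (s + (m + 1 : ℕ) * d) : ENNReal)) := by
      intro ω
      simp only [hP, Finset.prod_range_succ]; ring
    change ∫⁻ ω, P (m + 1) ω ∂μ ≤ _
    simp only [e]
    have hPm' := (hPm m).mono (ℱ.le _) le_rfl
    rw [lintegral_add_left hPm', lintegral_const_mul' _ _ ENNReal.coe_ne_top]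
    have h1 := h.lintegral_mul_jumps_le (hmono (Nat.le_succ m)) (hPm m)
    have h2 : ((s + (m + 1 : ℕ) * d : ℝ≥0) : ℝ) - (s + m * d : ℝ≥0) = d := by push_cast; ring
    simp only [Nat.succ_eq_add_one, h2] at h1
    have hr : 0 ≤ S.totalRate * d := mul_nonneg S.totalRate_nonneg d.coe_nonneg
    have h3 : ENNReal.ofReal (1 + a * (S.totalRate * d))
        = 1 + a * ENNReal.ofReal (S.totalRate * d) := by
      rw [ENNReal.ofReal_add zero_le_one (mul_nonneg a.coe_nonneg hr), ENNReal.ofReal_mul a.coe_nonneg,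
        ENNReal.ofReal_one, ENNReal.ofReal_coe_nnreal]
    calc _ ≤ ∫⁻ ω, P m ω ∂μ
          + a * (ENNReal.ofReal (S.totalRate * d) * ∫⁻ ω, P m ω ∂μ) := by gcongr
      _ = ENNReal.ofReal (1 + a * (S.totalRate * d)) * ∫⁻ ω, P m ω ∂μ := by rw [h3]; ring
      _ ≤ ENNReal.ofReal (1 + a * (S.totalRate * d)) *
          (ENNReal.ofReal (1 + a * (S.totalRate * d)) ^ m * ∫⁻ ω, Z ω ∂μ) := by gcongr
      _ = _ := by ring

/-- Exponential moments of the number of transitions in `(s, t]`, conditionally on the past. -/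
theorem lintegral_mul_pow_jumps_le (h : S.IsRealization μ ℱ N q x) (a : ℝ≥0) {s t : ℝ≥0}
    (hst : s ≤ t) {Z : Ω → ENNReal} (hZ : Measurable[ℱ s] Z) :
    ∫⁻ ω, Z ω * (1 + a) ^ jumps (fun l t => N l t ω) s t ∂μ ≤
      ENNReal.ofReal (Real.exp (a * (S.totalRate * ((t : ℝ) - s)))) * ∫⁻ ω, Z ω ∂μ := by
  have hst' : 0 ≤ (t : ℝ) - s := sub_nonneg.2 (NNReal.coe_le_coe.2 hst)
  set d : ℕ → ℝ≥0 := fun m => (t - s) / (m + 1 : ℕ) with hd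
  have hdm : ∀ m : ℕ, s + (m + 1 : ℕ) * d m = t := fun m => by
    have : ((m + 1 : ℕ) : ℝ≥0) ≠ 0 := Nat.cast_ne_zero.2 (Nat.succ_ne_zero m)
    rw [hd, mul_div_cancel₀ _ this, add_tsub_cancel_of_le hst]
  have hdr : ∀ m : ℕ, (d m : ℝ) = ((t : ℝ) - s) / (m + 1 : ℕ) := fun m => by
    rw [hd, NNReal.coe_div, NNReal.coe_sub hst, NNReal.coe_natCast]
  set P : ℕ → Ω → ENNReal := fun m ω => Z ω * ∏ i ∈ Finset.range (m + 1),
    (1 + a * (jumps (fun l t => N l t ω) (s + i * d m) (s + (i + 1 : ℕ) * d m) : ENNReal)) with hP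
  have hPm : ∀ m, Measurable (P m) := by
    intro m
    refine (hZ.mono (ℱ.le s) le_rfl).mul (Finset.measurable_fun_prod _ fun i hi => ?_)
    refine Measurable.const_add (Measurable.const_mul (measurable_from_top.comp ?_) _) _
    refine (h.measurable_jumps ?_).mono (ℱ.le _) le_rfl
    gcongr; simp
  have hPb : ∀ m, ∫⁻ ω, P m ω ∂μ ≤
      ENNReal.ofReal (Real.exp (a * (S.totalRate * ((t : ℝ) - s)))) * ∫⁻ ω, Z ω ∂μ := by
    intro m
    refine (h.lintegral_mul_prod_le a s (d m) hZ (m + 1)).trans ?_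
    gcongr
    have hnn : 0 ≤ a * (S.totalRate * (d m : ℝ)) :=
      mul_nonneg a.coe_nonneg (mul_nonneg S.totalRate_nonneg (d m).coe_nonneg)
    rw [← ENNReal.ofReal_pow (by linarith)]
    refine ENNReal.ofReal_le_ofReal ?_
    calc (1 + a * (S.totalRate * (d m : ℝ))) ^ (m + 1)
        ≤ Real.exp (a * (S.totalRate * (d m : ℝ))) ^ (m + 1) := by
          refine pow_le_pow_left₀ (by linarith) ?_ _
          rw [add_comm]; exact Real.add_one_le_exp _
      _ = _ := by
          rw [← Real.exp_nat_mul, hdr]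
          congr 1
          have : ((m + 1 : ℕ) : ℝ) ≠ 0 := Nat.cast_ne_zero.2 (Nat.succ_ne_zero m)
          field_simp
  -- Once the mesh is below the separation of the jumps, each cell count `k` is `0` or `1`, so `1 +
  -- a * k = (1 + a) ^ k` and the product is the desired power. Fatou's lemma then transfers the
  -- uniform bound.
  have hlim : ∀ᵐ ω ∂μ, Z ω * (1 + a) ^ jumps (fun l t => N l t ω) s t ≤
      liminf (fun m => P m ω) atTop := by
    filter_upwards [h.path] with ω hω
    obtain ⟨δ, hδ, hsep⟩ := hω.exists_pos_total_le_succ t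
    have hto : Tendsto (fun m : ℕ => (d m : ℝ)) atTop (𝓝 0) := by
      simp only [hdr]
      exact (tendsto_const_div_atTop_nhds_zero_nat ((t : ℝ) - s)).comp (tendsto_add_atTop_nat 1)
    refine le_liminf_of_le (by isBoundedDefault) ?_
    filter_upwards [hto.eventually_lt_const hδ] with m hm
    refine le_of_eq ?_
    have hmono : Monotone fun i : ℕ => s + i * d m := fun i j hij => by dsimp only; gcongr
    have hone : ∀ i ∈ Finset.range (m + 1),
        (1 + a * (jumps (fun l t => N l t ω) (s + i * d m) (s + (i + 1 : ℕ) * d m) : ENNReal))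
        = (1 + a) ^ jumps (fun l t => N l t ω) (s + i * d m) (s + (i + 1 : ℕ) * d m) := by
      intro i hi
      have hit : s + (i + 1 : ℕ) * d m ≤ t :=
        (hmono (Nat.succ_le_of_lt (Finset.mem_range.1 hi))).trans_eq (hdm m)
      have h1 := hsep (s + i * d m) (s + (i + 1 : ℕ) * d m) (hmono (Nat.le_succ i)) hit (by
        push_cast; linarith)
      have h2 := hω.total_eq_add_jumps (hmono (Nat.le_succ i))
      simp only [Nat.succ_eq_add_one] at h2
      have h3 : jumps (fun l t => N l t ω) (s + i * d m) (s + (i + 1 : ℕ) * d m) ≤ 1 := by omega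
      interval_cases jumps (fun l t => N l t ω) (s + i * d m) (s + (i + 1 : ℕ) * d m) <;> simp
    have hsum : ∀ k : ℕ, ∑ i ∈ Finset.range k,
        jumps (fun l t => N l t ω) (s + i * d m) (s + (i + 1 : ℕ) * d m)
        = jumps (fun l t => N l t ω) s (s + k * d m) := by
      intro k
      induction k with
      | zero => simp [jumps]
      | succ k ih =>
        rw [Finset.sum_range_succ, ih]
        have h1 := hω.total_eq_add_jumps (hmono (Nat.le_succ k))
        have h2 := hω.total_eq_add_jumps (s := s) (t := s + k * d m) (by simp)
        have h3 := hω.total_eq_add_jumps (s := s) (t := s + (k + 1 : ℕ) * d m) (by simp)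
        simp only [Nat.succ_eq_add_one] at h1
        omega
    simp only [hP]
    rw [Finset.prod_congr rfl hone, Finset.prod_pow_eq_pow_sum, hsum, hdm]
  calc _ ≤ ∫⁻ ω, liminf (fun m => P m ω) atTop ∂μ := lintegral_mono_ae hlim
    _ ≤ liminf (fun m => ∫⁻ ω, P m ω ∂μ) atTop := lintegral_liminf_le hPm
    _ ≤ liminf (fun _ : ℕ => ENNReal.ofReal (Real.exp (a * (S.totalRate * ((t : ℝ) - s))))
          * ∫⁻ ω, Z ω ∂μ) atTop := liminf_le_liminf (Eventually.of_forall hPb)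
    _ = _ := liminf_const _

end IsRealization

/-! ### Affine observables and their change along paths. -/

/-- The observable `α_q + β_q · x` of the state `(q, x)`. -/
def obs (α : Q → ℝ) (β : Q → Fin (n + 1) → ℝ) (a : Q) (y : Fin (n + 1) → ℝ) : ℝ :=
  α a + β a ⬝ᵥ y

/-- The change of an observable in the transition `l` from the continuous state `y`. -/
def obsJump (S : AoISHS Q L n) (α : Q → ℝ) (β : Q → Fin (n + 1) → ℝ) (l : L)
    (y : Fin (n + 1) → ℝ) : ℝ :=
  obs α β (S.dst l) (y ᵥ* S.A l) - obs α β (S.src l) y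

open Classical in
/-- The extended generator of the stochastic hybrid system on the observable `α_q + β_q · x`. -/
noncomputable def generator [Fintype L] (S : AoISHS Q L n) (α : Q → ℝ)
    (β : Q → Fin (n + 1) → ℝ) (a : Q) (y : Fin (n + 1) → ℝ) : ℝ :=
  β a ⬝ᵥ S.b a + ∑ l, S.rate l * ((if a = S.src l then 1 else 0) * S.obsJump α β l y)

/-- `B` bounds the coefficients of the observable `α_q + β_q · x`. -/
structure ObsBound (α : Q → ℝ) (β : Q → Fin (n + 1) → ℝ) (B : ℝ) : Prop where
  const : ∀ a, |α a| ≤ B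
  lin : ∀ a y, |β a ⬝ᵥ y| ≤ B * ‖y‖

theorem exists_obsBound [Fintype Q] (α : Q → ℝ) (β : Q → Fin (n + 1) → ℝ) :
    ∃ B, 0 ≤ B ∧ ObsBound α β B := by
  refine ⟨∑ a, (|α a| + ∑ j, |β a j|), by positivity, fun a => ?_, fun a y => ?_⟩
  · exact (le_add_of_nonneg_right (by positivity)).trans
      (Finset.single_le_sum (f := fun a => |α a| + ∑ j, |β a j|)
        (fun a _ => by positivity) (Finset.mem_univ a))
  · calc |β a ⬝ᵥ y| ≤ ∑ j, |β a j * y j| := Finset.abs_sum_le_sum_abs _ _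
      _ ≤ ∑ j, |β a j| * ‖y‖ := Finset.sum_le_sum fun j _ => by
          rw [abs_mul]; exact mul_le_mul_of_nonneg_left (norm_le_pi_norm y j) (abs_nonneg _)
      _ = (∑ j, |β a j|) * ‖y‖ := (Finset.sum_mul _ _ _).symm
      _ ≤ _ := by
          refine mul_le_mul_of_nonneg_right ?_ (norm_nonneg _)
          exact (le_add_of_nonneg_left (abs_nonneg _)).trans
            (Finset.single_le_sum (f := fun a => |α a| + ∑ j, |β a j|)
              (fun a _ => by positivity) (Finset.mem_univ a))

namespace ObsBound

variable {S : AoISHS Q L n} {α : Q → ℝ} {β : Q → Fin (n + 1) → ℝ} {B : ℝ}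

theorem abs_obs_le (hB : ObsBound α β B) (a : Q) (y : Fin (n + 1) → ℝ) :
    |obs α β a y| ≤ B * (1 + ‖y‖) := by
  rw [obs, mul_add, mul_one]
  exact (abs_add_le _ _).trans (add_le_add (hB.const a) (hB.lin a y))

theorem abs_obsJump_le (hB : ObsBound α β B) (hB0 : 0 ≤ B) (l : L) (y : Fin (n + 1) → ℝ) :
    |S.obsJump α β l y| ≤ B * (n + 2) * (1 + ‖y‖) := by
  have h1 := hB.abs_obs_le (S.dst l) (y ᵥ* S.A l)
  have h2 := hB.abs_obs_le (S.src l) y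
  have h3 : B * (1 + ‖y ᵥ* S.A l‖) ≤ B * (1 + (n + 1) * ‖y‖) := by
    have := S.norm_vecMul_A_le l y
    gcongr
  have h4 : 0 ≤ B * n := by positivity
  refine (abs_sub _ _).trans ((add_le_add (h1.trans h3) h2).trans ?_)
  linarith

theorem abs_dot_b_le (hB : ObsBound α β B) (hB0 : 0 ≤ B) (a a' : Q) :
    |β a ⬝ᵥ S.b a'| ≤ B :=
  (hB.lin a _).trans (mul_le_of_le_one_right hB0 (S.norm_b_le a'))

theorem abs_generator_le [Fintype L] (hB : ObsBound α β B) (hB0 : 0 ≤ B) (a : Q)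
    (y : Fin (n + 1) → ℝ) :
    |S.generator α β a y| ≤ B * (1 + S.totalRate * (n + 2)) * (1 + ‖y‖) := by
  classical
  have h1 : |∑ l, S.rate l * ((if a = S.src l then 1 else 0) * S.obsJump α β l y)|
      ≤ ∑ l, S.rate l * (B * (n + 2) * (1 + ‖y‖)) := by
    refine (Finset.abs_sum_le_sum_abs _ _).trans (Finset.sum_le_sum fun l _ => ?_)
    rw [abs_mul, abs_of_nonneg (S.rate_nonneg l), abs_mul]
    refine mul_le_mul_of_nonneg_left (le_trans ?_ (hB.abs_obsJump_le (S := S) hB0 l y))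
      (S.rate_nonneg l)
    refine mul_le_of_le_one_left (abs_nonneg _) ?_
    split_ifs <;> simp
  rw [← Finset.sum_mul] at h1
  have h2 : 0 ≤ B * ‖y‖ := by positivity
  calc |S.generator α β a y| ≤ B + (∑ l, S.rate l) * (B * (n + 2) * (1 + ‖y‖)) :=
        (abs_add_le _ _).trans (add_le_add (hB.abs_dot_b_le hB0 a a) h1)
    _ ≤ _ := by rw [totalRate]; linarith

end ObsBound

namespace IsPath

variable [Fintype L] {S : AoISHS Q L n} {N : L → ℝ≥0 → ℕ} {q : ℝ≥0 → Q}
  {x : ℝ≥0 → Fin (n + 1) → ℝ} {α : Q → ℝ} {β : Q → Fin (n + 1) → ℝ} {B : ℝ}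

open Classical in
/-- The change of an observable in a short time interval: the drift, the jump if there is just
one, and an error that is small in expectation. -/
theorem abs_obs_sub_le (h : S.IsPath N q x) (hB : ObsBound α β B) (hB0 : 0 ≤ B) {s t : ℝ≥0}
    (hst : s < t) (hsmall : (n + 2) * ((t : ℝ) - s) ≤ 1) :
    |obs α β (q t) (x t) - obs α β (q s) (x s) - ((t : ℝ) - s) * (β (q s) ⬝ᵥ S.b (q s))
      - ∑ l, (if q s = S.src l then 1 else 0) * S.obsJump α β l (x s) * ((N l t : ℝ) - N l s)|
      ≤ B * (n + 6) * (1 + ‖x s‖) * (((t : ℝ) - s) * jumps N s t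
        + ((n + 2) * ((t : ℝ) - s)) ^ 2 * (1 / ((t : ℝ) - s)) ^ jumps N s t) := by
  set d : ℝ := (t : ℝ) - s with hd
  have hd0 : 0 < d := sub_pos.2 (NNReal.coe_lt_coe.2 hst)
  have hn : (0 : ℝ) ≤ n := n.cast_nonneg
  have hd1 : d ≤ 1 := by nlinarith
  have htot := h.total_eq_add_jumps hst.le
  have hx : (0 : ℝ) ≤ ‖x s‖ := norm_nonneg _
  have hC : 0 ≤ B * (n + 6) * (1 + ‖x s‖) := by positivity
  obtain ⟨D, hD⟩ : ∃ D, jumps N s t = D := ⟨_, rfl⟩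
  rw [hD] at htot ⊢
  -- No jump: the drift is exact. One jump: the error is of order `d`. Two or more: every term is
  -- bounded crudely, by powers of `n + 2`.
  rcases D with _ | _ | D
  · have hc := h.count_eq_of_total_eq hst.le htot
    obtain ⟨hq, hxt⟩ := h.flow_of_total_eq hst.le htot
    have hs : ∑ l, (if q s = S.src l then 1 else 0) * S.obsJump α β l (x s)
        * ((N l t : ℝ) - N l s) = 0 :=
      Finset.sum_eq_zero fun l _ => by rw [hc l]; ring
    have e : obs α β (q t) (x t) - obs α β (q s) (x s) - d * (β (q s) ⬝ᵥ S.b (q s)) = 0 := by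
      rw [hq, hxt, obs, obs, dotProduct_add, dotProduct_smul, smul_eq_mul]; ring
    rw [hs, e]
    simp only [sub_zero, abs_zero]
    positivity
  · obtain ⟨l, hl, hk, hqs, hqt, hxt⟩ := h.exists_jump_of_total_eq_succ hst.le htot
    have hs : ∑ l, (if q s = S.src l then 1 else 0) * S.obsJump α β l (x s)
        * ((N l t : ℝ) - N l s) = S.obsJump α β l (x s) := by
      rw [Finset.sum_eq_single l]
      · rw [hl, if_pos hqs]; push_cast; ring
      · intro k _ hkl; rw [hk k hkl]; ring
      · simp
    have e : obs α β (q t) (x t) - obs α β (q s) (x s) - d * (β (q s) ⬝ᵥ S.b (q s))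
        - S.obsJump α β l (x s)
        = β (S.dst l) ⬝ᵥ (x t - x s ᵥ* S.A l) - d * (β (q s) ⬝ᵥ S.b (q s)) := by
      rw [obsJump, hqt, hqs]
      simp only [obs, dotProduct_sub]
      ring
    rw [hs, e]
    have h1 : |β (S.dst l) ⬝ᵥ (x t - x s ᵥ* S.A l)| ≤ B * ((n + 1) * d) :=
      (hB.lin _ _).trans (mul_le_mul_of_nonneg_left hxt hB0)
    have h2 : |d * (β (q s) ⬝ᵥ S.b (q s))| ≤ d * B := by
      rw [abs_mul, abs_of_pos hd0]
      exact mul_le_mul_of_nonneg_left (hB.abs_dot_b_le hB0 _ _) hd0.le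
    have h3 : B * (n + 6) * 1 ≤ B * (n + 6) * (1 + ‖x s‖) := by gcongr; linarith
    calc _ ≤ B * ((n + 1) * d) + d * B := (abs_sub _ _).trans (add_le_add h1 h2)
      _ ≤ B * (n + 6) * 1 * (d * ((0 + 1 : ℕ) : ℝ)) := by
          push_cast
          have : 0 ≤ B * d := by positivity
          linarith
      _ ≤ B * (n + 6) * (1 + ‖x s‖) * (d * ((0 + 1 : ℕ) : ℝ)) := by gcongr
      _ ≤ _ := by
          refine mul_le_mul_of_nonneg_left (le_add_of_nonneg_right ?_) hC
          positivity
  · set E := D + 1 + 1 with hE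
    set R : ℝ := n + 2 with hR
    have hR2 : 2 ≤ R := by linarith
    have hRE : 1 ≤ R ^ E := one_le_pow₀ (by linarith)
    have hER : (E : ℝ) ≤ R ^ E := by
      have h1 : (E : ℝ) ≤ 2 ^ E := by exact_mod_cast (Nat.lt_two_pow_self (n := E)).le
      exact h1.trans (by gcongr)
    have hxt : ‖x t‖ ≤ R ^ E * (1 + ‖x s‖) := by
      refine (h.norm_le hst.le htot).trans ?_
      refine mul_le_mul (pow_le_pow_left₀ (by positivity) (by linarith) _) ?_ (by positivity)
        (by positivity)
      linarith
    have hs : |∑ l, (if q s = S.src l then 1 else 0) * S.obsJump α β l (x s)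
        * ((N l t : ℝ) - N l s)| ≤ B * R * (1 + ‖x s‖) * R ^ E := by
      calc _ ≤ ∑ l, B * R * (1 + ‖x s‖) * ((N l t : ℝ) - N l s) := by
            refine (Finset.abs_sum_le_sum_abs _ _).trans (Finset.sum_le_sum fun l _ => ?_)
            have hm : 0 ≤ (N l t : ℝ) - N l s :=
              sub_nonneg.2 (Nat.cast_le.2 (h.count_mono l hst.le))
            rw [abs_mul, abs_mul, abs_of_nonneg hm]
            refine mul_le_mul_of_nonneg_right ?_ hm
            refine le_trans (mul_le_of_le_one_left (abs_nonneg _) ?_) (hB.abs_obsJump_le hB0 l _)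
            split_ifs <;> simp
        _ = B * R * (1 + ‖x s‖) * (E : ℝ) := by
            rw [← Finset.mul_sum, Finset.sum_sub_distrib]
            congr 1
            have : ((∑ l, N l t : ℕ) : ℝ) = ((∑ l, N l s + E : ℕ) : ℝ) := by rw [htot]
            push_cast at this
            linarith
        _ ≤ _ := by gcongr
    have h1 : |obs α β (q t) (x t)| ≤ B * (2 * (R ^ E * (1 + ‖x s‖))) := by
      refine (hB.abs_obs_le _ _).trans (mul_le_mul_of_nonneg_left ?_ hB0)
      nlinarith
    have h2 : |obs α β (q s) (x s)| ≤ B * (R ^ E * (1 + ‖x s‖)) := by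
      refine (hB.abs_obs_le _ _).trans (mul_le_mul_of_nonneg_left ?_ hB0)
      nlinarith
    have h3 : |d * (β (q s) ⬝ᵥ S.b (q s))| ≤ B * (R ^ E * (1 + ‖x s‖)) := by
      rw [abs_mul, abs_of_pos hd0]
      refine (mul_le_of_le_one_left (abs_nonneg _) hd1).trans
        ((hB.abs_dot_b_le hB0 _ _).trans (le_mul_of_one_le_right hB0 ?_))
      nlinarith
    -- Since `R ≤ 1 / d` and `E ≥ 2`, two factors `d` can be extracted; the remaining weight `(1 /
    -- d) ^ E` has bounded expectation.
    have h4 : R ^ E ≤ (R * d) ^ 2 * (1 / d) ^ E := by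
      have e1 : (R * d) ^ 2 * (1 / d) ^ E = R ^ 2 * (1 / d) ^ D := by
        have e3 : 1 / d * d = 1 := one_div_mul_cancel hd0.ne'
        calc (R * d) ^ 2 * (1 / d) ^ E = R ^ 2 * (1 / d) ^ D * (1 / d * d) ^ 2 := by
              rw [hE]; ring
          _ = _ := by rw [e3]; ring
      have e2 : R ≤ 1 / d := by rwa [le_div_iff₀ hd0]
      rw [e1, hE, pow_succ, pow_succ, mul_assoc, ← pow_two, mul_comm]
      gcongr
    calc _ ≤ B * (2 * (R ^ E * (1 + ‖x s‖))) + B * (R ^ E * (1 + ‖x s‖))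
          + B * (R ^ E * (1 + ‖x s‖)) + B * R * (1 + ‖x s‖) * R ^ E :=
          (abs_sub _ _).trans (add_le_add ((abs_sub _ _).trans
            (add_le_add ((abs_sub _ _).trans (add_le_add h1 h2)) h3)) hs)
      _ = B * (n + 6) * (1 + ‖x s‖) * R ^ E := by rw [hR]; ring
      _ ≤ B * (n + 6) * (1 + ‖x s‖) * ((R * d) ^ 2 * (1 / d) ^ E) := by gcongr
      _ ≤ _ := by
          refine mul_le_mul_of_nonneg_left (le_add_of_nonneg_left ?_) hC
          positivity

end IsPath

/-! ### Integrability and the short-time expansion of expectations. -/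

namespace IsRealization

variable [Fintype L] {S : AoISHS Q L n} {Ω : Type*} [mΩ : MeasurableSpace Ω] {μ : Measure Ω}
  {ℱ : Filtration ℝ≥0 mΩ} {N : L → ℝ≥0 → Ω → ℕ} {q : ℝ≥0 → Ω → Q}
  {x : ℝ≥0 → Ω → Fin (n + 1) → ℝ}

theorem measurable_comp_state [Fintype Q] (h : S.IsRealization μ ℱ N q x) (t : ℝ≥0)
    {F : Q → (Fin (n + 1) → ℝ) → ℝ} (hF : ∀ a, Measurable (F a)) :
    Measurable[ℱ t] fun ω => F (q t ω) (x t ω) := by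
  classical
  have e : (fun ω => F (q t ω) (x t ω))
      = fun ω => ∑ a, {ω | q t ω = a}.indicator (fun ω => F a (x t ω)) ω := by
    funext ω
    simp [Set.indicator_apply]
  rw [e]
  exact Finset.measurable_fun_sum _ fun a _ =>
    ((hF a).comp (h.continuous_adapted t)).indicator (h.discrete_adapted t a)

omit [Fintype L] in
theorem integrable_and_integral_le_of_lintegral_le {f Z : Ω → ℝ} {c : ℝ} (hc : 0 ≤ c)
    (hf0 : ∀ ω, 0 ≤ f ω) (hf : Measurable f) (hZ0 : ∀ ω, 0 ≤ Z ω) (hZ : Integrable Z μ)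
    (hle : ∫⁻ ω, ENNReal.ofReal (f ω) ∂μ ≤ ENNReal.ofReal c * ∫⁻ ω, ENNReal.ofReal (Z ω) ∂μ) :
    Integrable f μ ∧ ∫ ω, f ω ∂μ ≤ c * ∫ ω, Z ω ∂μ := by
  rw [← ofReal_integral_eq_lintegral_ofReal hZ (ae_of_all _ hZ0), ← ENNReal.ofReal_mul hc] at hle
  have hfi : Integrable f μ := ⟨hf.aestronglyMeasurable, by
    rw [hasFiniteIntegral_iff_ofReal (ae_of_all _ hf0)]
    exact hle.trans_lt ENNReal.ofReal_lt_top⟩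
  refine ⟨hfi, ?_⟩
  rw [← ofReal_integral_eq_lintegral_ofReal hfi (ae_of_all _ hf0)] at hle
  exact (ENNReal.ofReal_le_ofReal_iff (mul_nonneg hc (integral_nonneg hZ0))).1 hle

variable [IsProbabilityMeasure μ]

theorem integrable_mul_jumps (h : S.IsRealization μ ℱ N q x) {s t : ℝ≥0} (hst : s ≤ t)
    {Z : Ω → ℝ} (hZm : Measurable[ℱ s] Z) (hZ0 : ∀ ω, 0 ≤ Z ω) (hZ : Integrable Z μ) :
    Integrable (fun ω => Z ω * jumps (fun l t => N l t ω) s t) μ ∧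
      ∫ ω, Z ω * jumps (fun l t => N l t ω) s t ∂μ
        ≤ S.totalRate * ((t : ℝ) - s) * ∫ ω, Z ω ∂μ := by
  refine integrable_and_integral_le_of_lintegral_le
    (mul_nonneg S.totalRate_nonneg (sub_nonneg.2 (NNReal.coe_le_coe.2 hst)))
    (fun ω => mul_nonneg (hZ0 ω) (Nat.cast_nonneg _))
    ((hZm.mono (ℱ.le s) le_rfl).mul
      (measurable_from_top.comp ((h.measurable_jumps hst).mono (ℱ.le t) le_rfl))) hZ0 hZ ?_
  refine le_trans (le_of_eq ?_)
    (h.lintegral_mul_jumps_le hst (Z := fun ω => ENNReal.ofReal (Z ω)) hZm.ennreal_ofReal)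
  simp only [ENNReal.ofReal_mul (hZ0 _), ENNReal.ofReal_natCast]

theorem integrable_mul_pow_jumps (h : S.IsRealization μ ℱ N q x) (a : ℝ≥0) {s t : ℝ≥0}
    (hst : s ≤ t) {Z : Ω → ℝ} (hZm : Measurable[ℱ s] Z) (hZ0 : ∀ ω, 0 ≤ Z ω)
    (hZ : Integrable Z μ) :
    Integrable (fun ω => Z ω * (1 + (a : ℝ)) ^ jumps (fun l t => N l t ω) s t) μ ∧
      ∫ ω, Z ω * (1 + (a : ℝ)) ^ jumps (fun l t => N l t ω) s t ∂μ
        ≤ Real.exp (a * (S.totalRate * ((t : ℝ) - s))) * ∫ ω, Z ω ∂μ := by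
  refine integrable_and_integral_le_of_lintegral_le (Real.exp_pos _).le
    (fun ω => mul_nonneg (hZ0 ω) (by positivity))
    ((hZm.mono (ℱ.le s) le_rfl).mul
      ((measurable_from_top (f := fun k : ℕ => (1 + (a : ℝ)) ^ k)).comp
        ((h.measurable_jumps hst).mono (ℱ.le t) le_rfl))) hZ0 hZ ?_
  refine le_trans (le_of_eq ?_)
    (h.lintegral_mul_pow_jumps_le a hst (Z := fun ω => ENNReal.ofReal (Z ω)) hZm.ennreal_ofReal)
  have e : ENNReal.ofReal (1 + (a : ℝ)) = 1 + a := by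
    rw [ENNReal.ofReal_add zero_le_one a.coe_nonneg, ENNReal.ofReal_one, ENNReal.ofReal_coe_nnreal]
  have h1 : (0 : ℝ) ≤ 1 + a := by positivity
  simp only [ENNReal.ofReal_mul (hZ0 _), ENNReal.ofReal_pow h1, e]

/-- The continuous state is integrable, locally uniformly in time. -/
theorem integrable_state (h : S.IsRealization μ ℱ N q x) (h0 : Integrable (x 0) μ) (t : ℝ≥0) :
    Integrable (x t) μ ∧
      ∫ ω, ‖x t ω‖ ∂μ ≤ Real.exp (n * (S.totalRate * t)) * (∫ ω, ‖x 0 ω‖ ∂μ + t) := by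
  have hZ : Integrable (fun ω => ‖x 0 ω‖ + t) μ := h0.norm.add (integrable_const _)
  -- The choice `a = n` makes `1 + a` the growth factor of a reset.
  obtain ⟨h1, h2⟩ := h.integrable_mul_pow_jumps n (zero_le (a := t))
    (Z := fun ω => ‖x 0 ω‖ + t) (Measurable.add_const (measurable_norm.comp (h.continuous_adapted 0)) _)
    (fun ω => by positivity) hZ
  have hle : ∀ᵐ ω ∂μ, ‖x t ω‖ ≤
      (‖x 0 ω‖ + t) * (1 + ((n : ℝ≥0) : ℝ)) ^ jumps (fun l t => N l t ω) 0 t := by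
    filter_upwards [h.path] with ω hω
    have := hω.norm_le (zero_le (a := t)) (hω.total_eq_add_jumps zero_le)
    refine this.trans_eq ?_
    rw [NNReal.coe_zero, sub_zero, NNReal.coe_natCast]
    ring
  have hx : Integrable (x t) μ :=
    h1.mono' ((h.continuous_adapted t).mono (ℱ.le t) le_rfl).aestronglyMeasurable hle
  refine ⟨hx, (integral_mono_ae hx.norm h1 hle).trans (h2.trans_eq ?_)⟩
  rw [integral_add h0.norm (integrable_const _), integral_const]
  simp

variable [Fintype Q] {α : Q → ℝ} {β : Q → Fin (n + 1) → ℝ} {B : ℝ}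

omit [Fintype L] [Fintype Q] in
theorem _root_.AoISHS.measurable_obs (α : Q → ℝ) (β : Q → Fin (n + 1) → ℝ) (a : Q) :
    Measurable (obs α β a) := by
  unfold obs dotProduct
  fun_prop

omit [Fintype L] [Fintype Q] in
theorem _root_.AoISHS.measurable_obsJump (S : AoISHS Q L n) (α : Q → ℝ)
    (β : Q → Fin (n + 1) → ℝ) (l : L) : Measurable (S.obsJump α β l) := by
  unfold obsJump obs dotProduct Matrix.vecMul dotProduct
  fun_prop

theorem integrable_obs (h : S.IsRealization μ ℱ N q x) (h0 : Integrable (x 0) μ)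
    (α : Q → ℝ) (β : Q → Fin (n + 1) → ℝ) (t : ℝ≥0) :
    Integrable (fun ω => obs α β (q t ω) (x t ω)) μ := by
  obtain ⟨B, -, hB⟩ := exists_obsBound α β
  refine Integrable.mono' (((integrable_const 1).add (h.integrable_state h0 t).1.norm).const_mul B)
    ((h.measurable_comp_state t (measurable_obs α β)).mono (ℱ.le t) le_rfl).aestronglyMeasurable
    (ae_of_all _ fun ω => hB.abs_obs_le _ _)

theorem integrable_generator (h : S.IsRealization μ ℱ N q x) (h0 : Integrable (x 0) μ)
    (α : Q → ℝ) (β : Q → Fin (n + 1) → ℝ) (t : ℝ≥0) :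
    Integrable (fun ω => S.generator α β (q t ω) (x t ω)) μ := by
  obtain ⟨B, hB0, hB⟩ := exists_obsBound α β
  refine Integrable.mono' (((integrable_const 1).add (h.integrable_state h0 t).1.norm).const_mul _)
    ((h.measurable_comp_state t fun a => ?_).mono (ℱ.le t) le_rfl).aestronglyMeasurable
    (ae_of_all _ fun ω => hB.abs_generator_le hB0 _ _)
  have := S.measurable_obsJump α β
  unfold generator
  fun_prop

-- The drift and the single jumps give the generator after counts are replaced by compensators and
-- the intensities are frozen at time `s`. Each remaining error has expectation of order `(t - s) ^
-- 2`.
open Classical in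
theorem abs_integral_obs_sub_le (h : S.IsRealization μ ℱ N q x) (h0 : Integrable (x 0) μ)
    (hB : ObsBound α β B) (hB0 : 0 ≤ B) {s t : ℝ≥0} (hst : s < t)
    (hsmall : (n + 2) * ((t : ℝ) - s) ≤ 1) :
    |∫ ω, obs α β (q t ω) (x t ω) ∂μ - ∫ ω, obs α β (q s ω) (x s ω) ∂μ
        - ((t : ℝ) - s) * ∫ ω, S.generator α β (q s ω) (x s ω) ∂μ|
      ≤ B * ((n + 6) * (S.totalRate + (n + 2) ^ 2 * Real.exp S.totalRate)
        + (n + 2) * S.totalRate ^ 2) * (1 + ∫ ω, ‖x s ω‖ ∂μ) * ((t : ℝ) - s) ^ 2 := by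
  set d : ℝ := (t : ℝ) - s with hd
  have hd0 : 0 < d := sub_pos.2 (NNReal.coe_lt_coe.2 hst)
  have hn : (0 : ℝ) ≤ n := n.cast_nonneg
  have hd1 : d ≤ 1 := by nlinarith
  have hΛ := S.totalRate_nonneg
  set Λ := S.totalRate with hΛd
  set Z : Ω → ℝ := fun ω => 1 + ‖x s ω‖ with hZ
  have hZ0 : ∀ ω, 0 ≤ Z ω := fun ω => by positivity
  have hZm : Measurable[ℱ s] Z := 
    Measurable.const_add (measurable_norm.comp (h.continuous_adapted s)) 1
  have hxs := (h.integrable_state h0 s).1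
  have hZi : Integrable Z μ := (integrable_const 1).add hxs.norm
  have hZint : ∫ ω, Z ω ∂μ = 1 + ∫ ω, ‖x s ω‖ ∂μ := by
    rw [hZ, integral_add (integrable_const 1) hxs.norm, integral_const]; simp
  set D : Ω → ℕ := fun ω => jumps (fun l t => N l t ω) s t with hDdef
  -- With `1 + a = 1 / d` the exponent `a * Λ * d` equals `Λ * (1 - d)`, so the exponential moment
  -- is bounded uniformly in `d`.
  obtain ⟨a, ha⟩ : ∃ a : ℝ≥0, (a : ℝ) = 1 / d - 1 :=
    ⟨⟨_, by rw [sub_nonneg, le_div_iff₀ hd0]; linarith⟩, rfl⟩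
  have ha1 : (1 : ℝ) + a = 1 / d := by rw [ha]; ring
  obtain ⟨hi1, hle1⟩ := h.integrable_mul_jumps hst.le hZm hZ0 hZi
  obtain ⟨hi2, hle2⟩ := h.integrable_mul_pow_jumps a hst.le hZm hZ0 hZi
  rw [ha1] at hi2 hle2
  have hle2' : ∫ ω, Z ω * (1 / d) ^ D ω ∂μ ≤ Real.exp Λ * ∫ ω, Z ω ∂μ := by
    refine hle2.trans (mul_le_mul_of_nonneg_right ?_ (integral_nonneg hZ0))
    refine Real.exp_le_exp.2 ?_
    have e : (a : ℝ) * (Λ * d) = Λ * (1 - d) := by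
      rw [ha]; field_simp
    rw [← hd, e]
    nlinarith
  -- the weights of the transitions at time `s`
  set I : L → Ω → ℝ := fun l ω =>
    (if q s ω = S.src l then 1 else 0) * S.obsJump α β l (x s ω) with hI
  have hIm : ∀ l, Measurable[ℱ s] (I l) := fun l =>
    h.measurable_comp_state s (F := fun a y => (if a = S.src l then 1 else 0) * S.obsJump α β l y)
      fun a => (S.measurable_obsJump α β l).const_mul _
  have hIb : ∀ l ω, |I l ω| ≤ B * (n + 2) * Z ω := fun l ω => by
    rw [hI, abs_mul]
    refine le_trans (mul_le_of_le_one_left (abs_nonneg _) ?_) (hB.abs_obsJump_le hB0 l _)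
    split_ifs <;> simp
  have hIi : ∀ l, Integrable (I l) μ := fun l =>
    (hZi.const_mul (B * (n + 2))).mono' ((hIm l).mono (ℱ.le s) le_rfl).aestronglyMeasurable
      (ae_of_all _ (hIb l))
  have hNm : ∀ l t, Measurable fun ω => (N l t ω : ℝ) := fun l t =>
    measurable_from_top.comp ((h.count_adapted l t).mono (ℱ.le t) le_rfl)
  have hIN : ∀ l, Integrable (fun ω => I l ω * ((N l t ω : ℝ) - N l s ω)) μ := fun l => by
    refine (hi1.const_mul (B * (n + 2))).mono' (((hIm l).mono (ℱ.le s) le_rfl).mul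
      ((hNm l t).sub (hNm l s))).aestronglyMeasurable ?_
    filter_upwards [h.path] with ω hω
    have hm := hω.count_mono l hst.le
    have h1 : N l t ω - N l s ω ≤ D ω :=
      Finset.single_le_sum (f := fun l => N l t ω - N l s ω) (fun _ _ => Nat.zero_le _)
        (Finset.mem_univ l)
    rw [Real.norm_eq_abs, abs_mul, ← Nat.cast_sub hm, Nat.abs_cast, ← mul_assoc]
    exact mul_le_mul (hIb l ω) (Nat.cast_le.2 h1) (Nat.cast_nonneg _)
      (mul_nonneg (by positivity) (hZ0 ω))
  set c : L → ℝ≥0 → Ω → ℝ := fun l t ω => S.compensator l (fun t => q t ω) t with hc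
  have hci := h.integrable_compensator
  have hIc : ∀ l, Integrable (fun ω => I l ω * (c l t ω - c l s ω)) μ := fun l => by
    refine (hIi l).mul_bdd (c := S.rate l * t + S.rate l * s)
      ((hci l t).sub (hci l s)).1 (ae_of_all _ fun ω => ?_)
    exact (abs_sub _ _).trans (add_le_add (S.abs_compensator_le l _ t) (S.abs_compensator_le l _ s))
  have hmart : ∀ l, ∫ ω, I l ω * ((N l t ω : ℝ) - N l s ω) ∂μ
      = ∫ ω, I l ω * (c l t ω - c l s ω) ∂μ := fun l =>
    h.integral_mul_count_sub l hst.le (hIm l).stronglyMeasurable (hIi l) (hIN l)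
  -- both error terms
  set Y : Ω → ℝ := fun ω => obs α β (q t ω) (x t ω) - obs α β (q s ω) (x s ω)
    - d * S.generator α β (q s ω) (x s ω) with hY
  have hot := h.integrable_obs h0 α β t
  have hos := h.integrable_obs h0 α β s
  have hgs := (h.integrable_generator h0 α β s).const_mul d
  have hots : Integrable (fun ω => obs α β (q t ω) (x t ω) - obs α β (q s ω) (x s ω)) μ :=
    hot.sub hos
  have hYi : Integrable Y μ := hots.sub hgs
  have hYint : ∫ ω, Y ω ∂μ = ∫ ω, obs α β (q t ω) (x t ω) ∂μ - ∫ ω, obs α β (q s ω) (x s ω) ∂μ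
      - d * ∫ ω, S.generator α β (q s ω) (x s ω) ∂μ := by
    rw [hY, integral_sub hots hgs, integral_sub hot hos, integral_const_mul]
  -- The weights `I l` are known at time `s`, so this sum of weighted martingale increments has mean
  -- zero and can be subtracted freely.
  set W : Ω → ℝ := fun ω => ∑ l, I l ω * ((N l t ω : ℝ) - N l s ω)
    - ∑ l, I l ω * (c l t ω - c l s ω) with hW
  have hWi : Integrable W μ :=
    (integrable_finsetSum _ fun l _ => hIN l).sub (integrable_finsetSum _ fun l _ => hIc l)
  have hW0 : ∫ ω, W ω ∂μ = 0 := by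
    rw [hW, integral_sub (integrable_finsetSum _ fun l _ => hIN l)
      (integrable_finsetSum _ fun l _ => hIc l), integral_finsetSum _ fun l _ => hIN l,
      integral_finsetSum _ fun l _ => hIc l, sub_eq_zero]
    exact Finset.sum_congr rfl fun l _ => hmart l
  have hpt : ∀ᵐ ω ∂μ, |Y ω - W ω| ≤
      B * (n + 6) * (d * (Z ω * D ω) + ((n + 2) * d) ^ 2 * (Z ω * (1 / d) ^ D ω))
        + B * (n + 2) * Λ * d * (Z ω * D ω) := by
    filter_upwards [h.path] with ω hω
    have h1 := hω.abs_obs_sub_le hB hB0 hst hsmall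
    have h2 : ∑ l, |I l ω * (c l t ω - c l s ω
        - S.rate l * d * (if q s ω = S.src l then 1 else 0))| ≤
        ∑ l, B * (n + 2) * Z ω * (S.rate l * d * D ω) := by
      refine Finset.sum_le_sum fun l _ => ?_
      rw [abs_mul]
      exact mul_le_mul (hIb l ω) (hω.abs_compensator_sub_sub_le l hst.le) (abs_nonneg _)
        (mul_nonneg (by positivity) (hZ0 ω))
    have e1 : ∑ l, B * (n + 2) * Z ω * (S.rate l * d * D ω) = B * (n + 2) * Λ * d * (Z ω * D ω) := by
      rw [← Finset.mul_sum, ← Finset.sum_mul, ← Finset.sum_mul, hΛd, totalRate]; ring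
    have e2 : Y ω - W ω = (obs α β (q t ω) (x t ω) - obs α β (q s ω) (x s ω)
        - d * (β (q s ω) ⬝ᵥ S.b (q s ω)) - ∑ l, I l ω * ((N l t ω : ℝ) - N l s ω))
        + ∑ l, I l ω * (c l t ω - c l s ω
          - S.rate l * d * (if q s ω = S.src l then 1 else 0)) := by
      have e3 : ∑ l, I l ω * (c l t ω - c l s ω
          - S.rate l * d * (if q s ω = S.src l then 1 else 0))
          = ∑ l, I l ω * (c l t ω - c l s ω) - d * ∑ l, S.rate l * I l ω := by
        rw [Finset.mul_sum, ← Finset.sum_sub_distrib]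
        refine Finset.sum_congr rfl fun l _ => ?_
        simp only [hI]
        split_ifs <;> ring
      rw [e3]
      simp only [hY, hW, generator]
      ring
    rw [e2]
    refine (abs_add_le _ _).trans (add_le_add (h1.trans_eq ?_)
      ((Finset.abs_sum_le_sum_abs _ _).trans (h2.trans_eq e1)))
    ring
  have hb1 : Integrable (fun ω => d * (Z ω * D ω) + ((n + 2) * d) ^ 2 * (Z ω * (1 / d) ^ D ω)) μ :=
    (hi1.const_mul d).add (hi2.const_mul (((n + 2) * d) ^ 2))
  have hb2 := hi1.const_mul (B * (n + 2) * Λ * d)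
  have hEZ : 0 ≤ ∫ ω, Z ω ∂μ := integral_nonneg hZ0
  calc |∫ ω, obs α β (q t ω) (x t ω) ∂μ - ∫ ω, obs α β (q s ω) (x s ω) ∂μ
        - d * ∫ ω, S.generator α β (q s ω) (x s ω) ∂μ|
      = |∫ ω, (Y ω - W ω) ∂μ| := by rw [integral_sub hYi hWi, hW0, hYint, sub_zero]
    _ ≤ ∫ ω, |Y ω - W ω| ∂μ := abs_integral_le_integral_abs
    _ ≤ ∫ ω, (B * (n + 6) * (d * (Z ω * D ω) + ((n + 2) * d) ^ 2 * (Z ω * (1 / d) ^ D ω))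
        + B * (n + 2) * Λ * d * (Z ω * D ω)) ∂μ :=
        integral_mono_ae (hYi.sub hWi).abs ((hb1.const_mul _).add hb2) hpt
    _ = B * (n + 6) * (d * ∫ ω, Z ω * D ω ∂μ + ((n + 2) * d) ^ 2 * ∫ ω, Z ω * (1 / d) ^ D ω ∂μ)
        + B * (n + 2) * Λ * d * ∫ ω, Z ω * D ω ∂μ := by
        rw [integral_add (hb1.const_mul _) hb2, integral_const_mul, integral_const_mul]
        rw [integral_add (hi1.const_mul d) (hi2.const_mul (((n + 2) * d) ^ 2)),
          integral_const_mul, integral_const_mul]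
    _ ≤ B * (n + 6) * (d * (Λ * d * ∫ ω, Z ω ∂μ)
          + ((n + 2) * d) ^ 2 * (Real.exp Λ * ∫ ω, Z ω ∂μ))
        + B * (n + 2) * Λ * d * (Λ * d * ∫ ω, Z ω ∂μ) := by gcongr
    _ = _ := by rw [hZint]; ring

end IsRealization

/-! ### From quadratic error bounds to right derivatives and continuity. -/

section FirstOrder

variable {F F' : ℝ → ℝ}

theorem hasDerivWithinAt_Ici_of_abs_sub_le {K δ t : ℝ} (hδ : 0 < δ)
    (h : ∀ u, t < u → u - t ≤ δ → |F u - F t - (u - t) * F' t| ≤ K * (u - t) ^ 2) :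
    HasDerivWithinAt F (F' t) (Set.Ici t) t := by
  refine HasDerivWithinAt.of_isLittleO ?_
  refine Asymptotics.IsBigO.trans_isLittleO (g := fun u => ‖u - t‖ ^ 2) ?_
    ((Asymptotics.isLittleO_pow_sub_sub t one_lt_two).mono nhdsWithin_le_nhds)
  refine Asymptotics.IsBigO.of_bound K ?_
  filter_upwards [self_mem_nhdsWithin, nhdsWithin_le_nhds (Iio_mem_nhds (lt_add_of_pos_right t hδ))]
    with u (hu : t ≤ u) (hu' : u < t + δ)
  rw [smul_eq_mul, norm_pow, norm_norm, Real.norm_eq_abs, Real.norm_eq_abs, sq_abs]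
  rcases hu.eq_or_lt with rfl | hu
  · simp
  · exact h u hu (by linarith)

/-- Continuity from the left expands around base points before `t`, which is why the constants must
be uniform over bounded time intervals. -/
theorem continuousOn_Ici_of_abs_sub_le
    (h : ∀ T : ℝ, ∃ K δ : ℝ, 0 < δ ∧ ∀ s t, 0 ≤ s → s < t → t ≤ T → t - s ≤ δ →
      |F t - F s - (t - s) * F' s| ≤ K * (t - s) ^ 2 ∧ |F' s| ≤ K) :
    ContinuousOn F (Set.Ici 0) := by
  intro t (ht : 0 ≤ t)
  obtain ⟨K, δ, hδ, hK⟩ := h (t + 1)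
  have hlip : ∀ s u, 0 ≤ s → s < u → u ≤ t + 1 → u - s ≤ δ → u - s ≤ 1 →
      |F u - F s| ≤ 2 * K * |u - s| := by
    intro s u hs hsu hu hd hd1
    obtain ⟨h1, h2⟩ := hK s u hs hsu hu hd
    have hpos : 0 < u - s := sub_pos.2 hsu
    have hK0 : 0 ≤ K := (abs_nonneg _).trans h2
    have h3 : |(u - s) * F' s| ≤ (u - s) * K := by
      rw [abs_mul, abs_of_pos hpos]
      exact mul_le_mul_of_nonneg_left h2 hpos.le
    have h4 : K * (u - s) ^ 2 ≤ K * (u - s) :=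
      mul_le_mul_of_nonneg_left (by nlinarith) hK0
    have h5 := abs_add_le (F u - F s - (u - s) * F' s) ((u - s) * F' s)
    rw [sub_add_cancel] at h5
    rw [abs_of_pos hpos]
    linarith
  have hev : ∀ᶠ u in 𝓝[Set.Ici 0] t, ‖F u - F t‖ ≤ 2 * K * |u - t| := by
    have hm : 0 < min δ 1 := lt_min hδ one_pos
    filter_upwards [self_mem_nhdsWithin, nhdsWithin_le_nhds (Metric.ball_mem_nhds t hm)]
      with u (hu : 0 ≤ u) hut
    rw [Metric.mem_ball, Real.dist_eq, lt_min_iff] at hut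
    have hb1 := abs_lt.1 hut.1
    have hb2 := abs_lt.1 hut.2
    rw [Real.norm_eq_abs]
    rcases lt_trichotomy u t with hlt | rfl | hlt
    · rw [abs_sub_comm (F u), abs_sub_comm u]
      exact hlip u t hu hlt (by linarith) (by linarith) (by linarith)
    · simp
    · exact hlip t u ht hlt (by linarith) (by linarith) (by linarith)
  refine tendsto_iff_norm_sub_tendsto_zero.2 (squeeze_zero' (Eventually.of_forall fun _ =>
    norm_nonneg _) hev ?_)
  have hc : Continuous fun u : ℝ => 2 * K * |u - t| := by fun_prop
  have := hc.continuousAt (x := t)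
  simp only [ContinuousAt, sub_self, abs_zero, mul_zero] at this
  exact this.mono_left nhdsWithin_le_nhds

end FirstOrder

/-! ### State indicators and localized coordinates as observables. -/

section Coordinates

variable [DecidableEq Q]

theorem obs_single_zero (a c : Q) (y : Fin (n + 1) → ℝ) :
    obs (Pi.single a 1) 0 c y = if c = a then 1 else 0 := by
  simp [obs, Pi.single_apply]

theorem obs_zero_single (a c : Q) (j : Fin (n + 1)) (y : Fin (n + 1) → ℝ) :
    obs 0 (Pi.single a (Pi.single j 1)) c y = if c = a then y j else 0 := by
  rcases eq_or_ne c a with rfl | h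
  · simp [obs]
  · simp [obs, h]

theorem generator_single_zero [Fintype L] (S : AoISHS Q L n) (a c : Q)
    (y : Fin (n + 1) → ℝ) :
    S.generator (Pi.single a 1) 0 c y = ∑ l, S.rate l *
      ((if S.dst l = a then 1 else 0) - (if S.src l = a then 1 else 0)) *
        obs (Pi.single (S.src l) 1) 0 c y := by
  simp only [generator, obsJump, obs_single_zero, Pi.zero_apply, zero_dotProduct, zero_add]
  refine Finset.sum_congr rfl fun l _ => ?_
  rcases eq_or_ne c (S.src l) with h | h <;> simp [h]

/-- Linear resets and constant slopes keep the generator within indicators and localized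
coordinates, so the moment equations close. -/
theorem generator_zero_single [Fintype L] (S : AoISHS Q L n) (a c : Q) (j : Fin (n + 1))
    (y : Fin (n + 1) → ℝ) :
    S.generator 0 (Pi.single a (Pi.single j 1)) c y
      = S.b a j * obs (Pi.single a 1) 0 c y + ∑ l, S.rate l *
      ((if S.dst l = a then 1 else 0) *
          (∑ i, S.A l i j * obs 0 (Pi.single (S.src l) (Pi.single i 1)) c y)
        - (if S.src l = a then 1 else 0) *
          obs 0 (Pi.single (S.src l) (Pi.single j 1)) c y) := by
  simp only [generator, obsJump, obs_single_zero, obs_zero_single]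
  congr 1
  · rcases eq_or_ne c a with rfl | h
    · simp
    · simp [h]
  · refine Finset.sum_congr rfl fun l _ => ?_
    rcases eq_or_ne c (S.src l) with h | h
    · simp [h, Matrix.vecMul, dotProduct, mul_comm]
    · simp [h]

end Coordinates

/-! ### Dynkin's formula. -/

namespace IsRealization

variable [Fintype L] [Fintype Q] {S : AoISHS Q L n} {Ω : Type*} [mΩ : MeasurableSpace Ω]
  {μ : Measure Ω} [IsProbabilityMeasure μ] {ℱ : Filtration ℝ≥0 mΩ} {N : L → ℝ≥0 → Ω → ℕ}
  {q : ℝ≥0 → Ω → Q} {x : ℝ≥0 → Ω → Fin (n + 1) → ℝ}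

theorem exists_abs_integral_obs_sub_le (h : S.IsRealization μ ℱ N q x) (h0 : Integrable (x 0) μ)
    (α : Q → ℝ) (β : Q → Fin (n + 1) → ℝ) (T : ℝ) :
    ∃ K δ : ℝ, 0 < δ ∧ ∀ s t : ℝ, 0 ≤ s → s < t → t ≤ T → t - s ≤ δ →
      |∫ ω, obs α β (q t.toNNReal ω) (x t.toNNReal ω) ∂μ
        - ∫ ω, obs α β (q s.toNNReal ω) (x s.toNNReal ω) ∂μ
        - (t - s) * ∫ ω, S.generator α β (q s.toNNReal ω) (x s.toNNReal ω) ∂μ|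
        ≤ K * (t - s) ^ 2 ∧
      |∫ ω, S.generator α β (q s.toNNReal ω) (x s.toNNReal ω) ∂μ| ≤ K := by
  obtain ⟨B, hB0, hB⟩ := exists_obsBound α β
  have hΛ := S.totalRate_nonneg
  set M : ℝ := 1 + Real.exp (n * (S.totalRate * T)) * (∫ ω, ‖x 0 ω‖ ∂μ + T) with hM
  set C₁ : ℝ := B * ((n + 6) * (S.totalRate + (n + 2) ^ 2 * Real.exp S.totalRate)
    + (n + 2) * S.totalRate ^ 2) with hC₁
  set C₂ : ℝ := B * (1 + S.totalRate * (n + 2)) with hC₂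
  have hC₁0 : 0 ≤ C₁ := by positivity
  have hC₂0 : 0 ≤ C₂ := by positivity
  refine ⟨max (C₁ * M) (C₂ * M), 1 / (n + 2), by positivity, fun s t hs hst htT hd => ?_⟩
  have hx0 : 0 ≤ ∫ ω, ‖x 0 ω‖ ∂μ := integral_nonneg fun _ => norm_nonneg _
  have hsM : 1 + ∫ ω, ‖x s.toNNReal ω‖ ∂μ ≤ M := by
    have hsT : s ≤ T := by linarith
    have := (h.integrable_state h0 s.toNNReal).2
    rw [Real.coe_toNNReal s hs] at this
    have h1 : Real.exp (n * (S.totalRate * s)) * (∫ ω, ‖x 0 ω‖ ∂μ + s)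
        ≤ Real.exp (n * (S.totalRate * T)) * (∫ ω, ‖x 0 ω‖ ∂μ + T) := by gcongr
    linarith
  constructor
  · have hlt : s.toNNReal < t.toNNReal := (Real.toNNReal_lt_toNNReal_iff (by linarith)).2 hst
    have hts : ((t.toNNReal : ℝ≥0) : ℝ) - (s.toNNReal : ℝ≥0) = t - s := by
      rw [Real.coe_toNNReal s hs, Real.coe_toNNReal t (by linarith)]
    have := h.abs_integral_obs_sub_le h0 hB hB0 hlt (by
      rw [hts]; rw [le_div_iff₀ (by positivity)] at hd; linarith)
    rw [hts] at this
    refine this.trans (mul_le_mul_of_nonneg_right ?_ (sq_nonneg _))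
    exact (mul_le_mul_of_nonneg_left hsM hC₁0).trans (le_max_left _ _)
  · have hxi := (h.integrable_state h0 s.toNNReal).1
    have hi : Integrable (fun ω => C₂ * (1 + ‖x s.toNNReal ω‖)) μ :=
      ((integrable_const 1).add hxi.norm).const_mul C₂
    calc _ ≤ ∫ ω, |S.generator α β (q s.toNNReal ω) (x s.toNNReal ω)| ∂μ :=
          abs_integral_le_integral_abs
      _ ≤ ∫ ω, C₂ * (1 + ‖x s.toNNReal ω‖) ∂μ :=
          integral_mono (h.integrable_generator h0 α β _).abs hi
            fun ω => hB.abs_generator_le hB0 _ _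
      _ = C₂ * (1 + ∫ ω, ‖x s.toNNReal ω‖ ∂μ) := by
          rw [integral_const_mul, integral_add (integrable_const 1) hxi.norm, integral_const]
          simp
      _ ≤ C₂ * M := mul_le_mul_of_nonneg_left hsM hC₂0
      _ ≤ _ := le_max_right _ _

/-- Dynkin's formula, in differential form. -/
theorem hasDerivWithinAt_integral_obs (h : S.IsRealization μ ℱ N q x) (h0 : Integrable (x 0) μ)
    (α : Q → ℝ) (β : Q → Fin (n + 1) → ℝ) {t : ℝ} (ht : 0 ≤ t) :
    HasDerivWithinAt (fun t : ℝ => ∫ ω, obs α β (q t.toNNReal ω) (x t.toNNReal ω) ∂μ)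
      (∫ ω, S.generator α β (q t.toNNReal ω) (x t.toNNReal ω) ∂μ) (Set.Ici t) t := by
  obtain ⟨K, δ, hδ, hK⟩ := h.exists_abs_integral_obs_sub_le h0 α β (t + 1)
  refine hasDerivWithinAt_Ici_of_abs_sub_le (K := K) (δ := min δ 1)
    (F' := fun t : ℝ => ∫ ω, S.generator α β (q t.toNNReal ω) (x t.toNNReal ω) ∂μ)
    (lt_min hδ one_pos) fun u hu hd => ?_
  have h1 := hd.trans (min_le_right _ _)
  exact (hK t u ht hu (by linarith) (hd.trans (min_le_left _ _))).1

theorem continuousOn_integral_obs (h : S.IsRealization μ ℱ N q x) (h0 : Integrable (x 0) μ)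
    (α : Q → ℝ) (β : Q → Fin (n + 1) → ℝ) :
    ContinuousOn (fun t : ℝ => ∫ ω, obs α β (q t.toNNReal ω) (x t.toNNReal ω) ∂μ) (Set.Ici 0) :=
  continuousOn_Ici_of_abs_sub_le
    (F' := fun t : ℝ => ∫ ω, S.generator α β (q t.toNNReal ω) (x t.toNNReal ω) ∂μ)
    (h.exists_abs_integral_obs_sub_le h0 α β)

end IsRealization

/-! ### The moment equations and convergence of the moments. -/

section Moments

variable [DecidableEq Q] {Ω : Type*} [MeasurableSpace Ω]

/-- The distribution of the discrete state at time `t`. -/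
noncomputable def discreteLaw (μ : Measure Ω) (q : ℝ≥0 → Ω → Q) (x : ℝ≥0 → Ω → Fin (n + 1) → ℝ)
    (t : ℝ) (a : Q) : ℝ :=
  ∫ ω, obs (Pi.single a 1) 0 (q t.toNNReal ω) (x t.toNNReal ω) ∂μ

/-- The expectations of the continuous state at time `t` on the events `{q t = a}`. -/
noncomputable def moment (μ : Measure Ω) (q : ℝ≥0 → Ω → Q) (x : ℝ≥0 → Ω → Fin (n + 1) → ℝ)
    (t : ℝ) (a : Q) (j : Fin (n + 1)) : ℝ :=
  ∫ ω, obs 0 (Pi.single a (Pi.single j 1)) (q t.toNNReal ω) (x t.toNNReal ω) ∂μ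

end Moments

namespace IsRealization

variable [Fintype L] [Fintype Q] [DecidableEq Q] {S : AoISHS Q L n} {Ω : Type*}
  [mΩ : MeasurableSpace Ω]
  {μ : Measure Ω} [IsProbabilityMeasure μ] {ℱ : Filtration ℝ≥0 mΩ} {N : L → ℝ≥0 → Ω → ℕ}
  {q : ℝ≥0 → Ω → Q} {x : ℝ≥0 → Ω → Fin (n + 1) → ℝ}

theorem hasDerivWithinAt_discreteLaw (h : S.IsRealization μ ℱ N q x) (h0 : Integrable (x 0) μ)
    {t : ℝ} (ht : 0 ≤ t) :
    HasDerivWithinAt (discreteLaw μ q x) (S.forward (discreteLaw μ q x t)) (Set.Ici t) t := by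
  refine hasDerivWithinAt_pi.2 fun a => ?_
  convert! h.hasDerivWithinAt_integral_obs h0 (Pi.single a 1) 0 ht using 1
  simp only [generator_single_zero]
  rw [integral_finsetSum _ fun l _ => (h.integrable_obs h0 _ _ _).const_mul _]
  simp only [integral_const_mul]
  change _ = ∑ l, S.rate l * _ * discreteLaw μ q x t (S.src l)
  rw [forward, outRate, Finset.sum_filter, Finset.sum_filter, Finset.sum_mul,
    ← Finset.sum_sub_distrib]
  refine Finset.sum_congr rfl fun l _ => ?_
  by_cases h1 : S.src l = a <;> by_cases h2 : S.dst l = a <;> simp [h1, h2]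

/-- The forcing contains the current law of the chain; it becomes the stationary one only in the
limit, since the initial law is arbitrary. -/
theorem hasDerivWithinAt_moment (h : S.IsRealization μ ℱ N q x) (h0 : Integrable (x 0) μ)
    {t : ℝ} (ht : 0 ≤ t) :
    HasDerivWithinAt (moment μ q x)
      (S.momentField (discreteLaw μ q x t) (moment μ q x t)) (Set.Ici t) t := by
  refine hasDerivWithinAt_pi.2 fun a => hasDerivWithinAt_pi.2 fun j => ?_
  convert! h.hasDerivWithinAt_integral_obs h0 0 (Pi.single a (Pi.single j 1)) ht using 1
  simp only [generator_zero_single]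
  have hi := fun α β => h.integrable_obs h0 α β t.toNNReal
  have hA : ∀ l, Integrable (fun ω => ∑ i, S.A l i j *
      obs 0 (Pi.single (S.src l) (Pi.single i 1)) (q t.toNNReal ω) (x t.toNNReal ω)) μ := fun l =>
    integrable_finsetSum _ fun i _ => (hi _ _).const_mul _
  have hl : ∀ l, Integrable (fun ω => S.rate l * ((if S.dst l = a then 1 else 0) *
          (∑ i, S.A l i j * obs 0 (Pi.single (S.src l) (Pi.single i 1)) (q t.toNNReal ω)
            (x t.toNNReal ω))
        - (if S.src l = a then 1 else 0) *
          obs 0 (Pi.single (S.src l) (Pi.single j 1)) (q t.toNNReal ω) (x t.toNNReal ω))) μ :=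
    fun l => (((hA l).const_mul _).sub ((hi _ _).const_mul _)).const_mul _
  rw [integral_add ((hi _ _).const_mul _) (integrable_finsetSum _ fun l _ => hl l),
    integral_finsetSum _ fun l _ => hl l]
  have e : ∀ l, ∫ ω, S.rate l * ((if S.dst l = a then 1 else 0) *
          (∑ i, S.A l i j * obs 0 (Pi.single (S.src l) (Pi.single i 1)) (q t.toNNReal ω)
            (x t.toNNReal ω))
        - (if S.src l = a then 1 else 0) *
          obs 0 (Pi.single (S.src l) (Pi.single j 1)) (q t.toNNReal ω) (x t.toNNReal ω)) ∂μ
      = S.rate l * ((if S.dst l = a then 1 else 0) * (moment μ q x t (S.src l) ᵥ* S.A l) j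
        - (if S.src l = a then 1 else 0) * moment μ q x t (S.src l) j) := by
    intro l
    rw [integral_const_mul, integral_sub ((hA l).const_mul _) ((hi _ _).const_mul _),
      integral_const_mul, integral_const_mul, integral_finsetSum _ fun i _ => (hi _ _).const_mul _]
    simp only [integral_const_mul, Matrix.vecMul, dotProduct, moment, mul_comm]
  rw [Finset.sum_congr rfl fun l _ => e l, integral_const_mul]
  change _ = S.b a j * discreteLaw μ q x t a + _
  rw [momentField_eq_add_linField]
  simp only [Pi.add_apply, Pi.smul_apply, smul_eq_mul, linField_apply]
  rw [outRate, Finset.sum_filter, Finset.sum_filter, Finset.sum_mul,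
    ← Finset.sum_sub_distrib, mul_comm (S.b a j)]
  congr 1
  refine Finset.sum_congr rfl fun l _ => ?_
  by_cases h1 : S.src l = a <;> by_cases h2 : S.dst l = a <;> simp [h1, h2, mul_sub]

theorem sum_discreteLaw (h : S.IsRealization μ ℱ N q x) (h0 : Integrable (x 0) μ) (t : ℝ) :
    ∑ a, discreteLaw μ q x t a = 1 := by
  simp only [discreteLaw]
  rw [← integral_finsetSum _ fun a _ => h.integrable_obs h0 _ _ _]
  simp [obs_single_zero]

theorem sum_moment (h : S.IsRealization μ ℱ N q x) (h0 : Integrable (x 0) μ) (t : ℝ)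
    (j : Fin (n + 1)) : ∑ a, moment μ q x t a j = ∫ ω, x t.toNNReal ω j ∂μ := by
  simp only [moment]
  rw [← integral_finsetSum _ fun a _ => h.integrable_obs h0 _ _ _]
  simp [obs_zero_single]

/-- The moments of the continuous state converge to the solution of the linear equations. -/
theorem tendsto_moment (h : S.IsRealization μ ℱ N q x) (h0 : Integrable (x 0) μ)
    (hrate : ∃ l, 0 < S.rate l) (herg : S.Ergodic) {p : Q → ℝ} (hp : S.IsStationary p)
    {w : Q → Fin (n + 1) → ℝ} (hw0 : ∀ q j, 0 ≤ w q j) (hw : S.IsBalanced p w)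
    (a : Q) (j : Fin (n + 1)) :
    Tendsto (fun t => moment μ q x t a j) atTop (𝓝 (w a j)) := by
  obtain ⟨u, c, hc, hu, huc⟩ := exists_contracting_weight hrate herg hp hw0 hw
  obtain ⟨u₀, hu₀, hu₀u⟩ := exists_pos_forall_lt_of_finite
    (f := fun i : Q × Fin (n + 1) => u i.1 i.2) fun i => hu _ _
  have hlawc : ContinuousOn (discreteLaw μ q x) (Set.Ici 0) :=
    continuousOn_pi.2 fun a => h.continuousOn_integral_obs h0 _ _
  have hmomc : ContinuousOn (moment μ q x) (Set.Ici 0) :=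
    continuousOn_pi.2 fun a => continuousOn_pi.2 fun j => h.continuousOn_integral_obs h0 _ _
  obtain ⟨η, hη, D, hD⟩ := exists_abs_le_exp_of_forward herg hp
    (d := fun t => discreteLaw μ q x t - p) (hlawc.sub continuousOn_const)
    (fun t ht => by
      convert! (h.hasDerivWithinAt_discreteLaw h0 ht).sub_const p using 1
      funext a
      have := hp.2.2 a
      simp only [forward, Pi.sub_apply, mul_sub, Finset.sum_sub_distrib]
      linarith)
    (fun t _ => by simp [Finset.sum_sub_distrib, h.sum_discreteLaw h0 t, hp.2.1])
  -- The decay rate must not exceed that of the forcing and must stay strictly below the contraction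
  -- rate `c`.
  set ν := min η (c / 2) with hν
  have hν0 : 0 < ν := lt_min hη (half_pos hc)
  have hνc : 0 < c - ν := by have := min_le_right η (c / 2); linarith
  set z : ℝ → Q → Fin (n + 1) → ℝ := fun t => moment μ q x t - w with hz
  -- The three summands cover the initial deviation, the forcing, and the strictness demanded by the
  -- comparison; `u₀` is a lower bound of the weight.
  set K := (‖z 0‖ + |D| / (c - ν) + 1) / u₀ with hK
  have hK0 : 0 ≤ K := by positivity
  have hKu : ∀ a j, ‖z 0‖ + |D| / (c - ν) + 1 ≤ K * u a j := fun a j => by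
    calc _ = K * u₀ := by rw [hK]; field_simp
      _ ≤ _ := mul_le_mul_of_nonneg_left (hu₀u (a, j)).le hK0
  have hDn : 0 ≤ |D| / (c - ν) := by positivity
  have key : ∀ t, 0 ≤ t → |z t a j| ≤ K * u a j * Real.exp (-ν * t) := fun t ht => by
    refine abs_le_of_hasDerivWithinAt_linField (D := |D|) hu huc
      (z := z) (r := fun t a => (discreteLaw μ q x t a - p a) • S.b a)
      (hmomc.sub continuousOn_const)
      (fun t ht => ?_) (fun t ht a j => ?_) hK0 (fun a j => ?_) (fun a j => ?_) ht a j
    · convert! (h.hasDerivWithinAt_moment h0 ht).sub_const w using 1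
      rw [show z t = moment μ q x t - w from rfl, linField_sub, momentField_eq_add_linField]
      funext a
      simp only [Pi.add_apply, Pi.sub_apply, linField_of_isBalanced hw, sub_smul]
      abel
    · rw [Pi.smul_apply, smul_eq_mul, abs_mul]
      have hb : |S.b a j| ≤ 1 := by rcases S.b_binary a j with hb | hb <;> simp [hb]
      refine (mul_le_of_le_one_right (abs_nonneg _) hb).trans ((hD t ht a).trans ?_)
      refine mul_le_mul (le_abs_self D) (Real.exp_le_exp.2 ?_) (Real.exp_pos _).le (abs_nonneg D)
      have := mul_le_mul_of_nonneg_right (min_le_left η (c / 2)) ht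
      linarith
    · have h1 : |D| / (c - ν) < K * u a j := by
        have := hKu a j
        have := norm_nonneg (z 0)
        linarith
      rw [div_lt_iff₀ hνc] at h1
      linarith
    · have h1 : |z 0 a j| ≤ ‖z 0‖ :=
        (norm_le_pi_norm (z 0 a) j).trans (norm_le_pi_norm (z 0) a)
      have := hKu a j
      linarith
  have hexp : Tendsto (fun t : ℝ => K * u a j * Real.exp (-ν * t)) atTop (𝓝 0) := by
    have : Tendsto (fun t : ℝ => -ν * t) atTop atBot :=
      tendsto_id.const_mul_atTop_of_neg (neg_neg_of_pos hν0)
    simpa using (Real.tendsto_exp_atBot.comp this).const_mul (K * u a j)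
  refine tendsto_iff_norm_sub_tendsto_zero.2 (squeeze_zero' (Eventually.of_forall fun _ =>
    norm_nonneg _) ?_ hexp)
  filter_upwards [eventually_ge_atTop 0] with t ht using key t ht

end IsRealization

end AoISHS

/-- If the discrete Markov chain of an age-of-information SHS is ergodic with stationary
distribution `p`, and `w` is a non-negative solution of the linear equations, then the moment
differential equation is stable and the average age `lim E[x_0(t)]` exists and is `∑ q, w q 0`,
whatever the initial state is. -/
theorem mainTheorem3 {Q L : Type*} [Fintype Q] [DecidableEq Q] [Fintype L] {n : ℕ}
    (S : AoISHS Q L n) (hrate : ∃ l, 0 < S.rate l) (herg : S.Ergodic)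
    (p : Q → ℝ) (hp : S.IsStationary p)
    (w : Q → Fin (n + 1) → ℝ) (hw_nonneg : ∀ q j, 0 ≤ w q j) (hw : S.IsBalanced p w) :
    S.MomentStable p w ∧
      ∀ {Ω : Type*} [mΩ : MeasurableSpace Ω] (μ : Measure Ω) [IsProbabilityMeasure μ]
        (ℱ : Filtration ℝ≥0 mΩ) (N : L → ℝ≥0 → Ω → ℕ) (q : ℝ≥0 → Ω → Q)
        (x : ℝ≥0 → Ω → Fin (n + 1) → ℝ),
        S.IsRealization μ ℱ N q x → (∀ j, Integrable (fun ω => x 0 ω j) μ) →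
          (∀ t, Integrable (fun ω => x t ω 0) μ) ∧
            Tendsto (fun t : ℝ≥0 => ∫ ω, x t ω 0 ∂μ) atTop (𝓝 (∑ q, w q 0)) := by
  refine ⟨AoISHS.momentStable_of_isBalanced hrate herg hp hw_nonneg hw, ?_⟩
  intro Ω mΩ μ _ ℱ N q x h hx
  have h0 : Integrable (x 0) μ := Integrable.of_eval hx
  refine ⟨fun t => (h.integrable_state h0 t).1.eval 0, ?_⟩
  have hlim : Tendsto (fun t : ℝ => ∑ a, AoISHS.moment μ q x t a 0) atTop (𝓝 (∑ q, w q 0)) :=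
    tendsto_finsetSum _ fun a _ => h.tendsto_moment h0 hrate herg hp hw_nonneg hw a 0
  refine (hlim.comp (NNReal.tendsto_coe_atTop.2 tendsto_id)).congr fun t => ?_
  simp only [Function.comp_apply, id_eq, h.sum_moment h0, Real.toNNReal_coe]
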